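/- Let $m$ be an infinite cardinal and let $T$ be a tree (of any cardinality, not necessarily locally finite) in which every vertex has degree at most $2^m$. Suppose that every non-identity automorphism of $T$ moves at least $m$ vertices (in particular this holds if the minimum number of vertices moved by a non-identity automorphism is exactly $m$, and it holds trivially if $T$ has no non-identity automorphism). Then $T$ is asymmetrizable, i.e. there is an asymmetrizing set, which means a set $S \subseteq V(T)$ such that the identity is the only automorphism $\varphi$ of $T$ with $\varphi(S) = S$. Moreover, calling two asymmetrizing sets $S, S'$ of $T$ equivalent if $\varphi(S) = S'$ for some automorphism $\varphi$ of $T$, the number $a(T)$ of equivalence classes of asymmetrizing sets of $T$ equals $2^{|T|}$, where $|T|$ is the cardinality of $V(T)$. -/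

import Mathlib

open scoped Cardinal

universe u

namespace AsymTree

/-- A set `S` of vertices of `G` is asymmetrizing if the identity is the only automorphism of `G`
which fixes `S` setwise.  (Both `S` and its complement are allowed to be empty.) -/
def IsAsymmetrizing {V : Type u} (G : SimpleGraph V) (S : Set V) : Prop :=
  ∀ φ : G ≃g G, φ '' S = S → φ = RelIso.refl G.Adj

/-- A graph is asymmetrizable if it has an asymmetrizing set of vertices. -/
def IsAsymmetrizable {V : Type u} (G : SimpleGraph V) : Prop :=
  ∃ S : Set V, IsAsymmetrizing G S

/-- Vertex sets `S` of `G` and `S'` of `G'` are equivalent if some isomorphism from `G` to `G'`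
maps `S` onto `S'`. -/
def Equivalent {V W : Type u} (G : SimpleGraph V) (G' : SimpleGraph W)
    (S : Set V) (S' : Set W) : Prop :=
  ∃ φ : G ≃g G', φ '' S = S'

/-- Equivalence of asymmetrizing sets of one graph `G`, as an equivalence relation. -/
def asymSetoid {V : Type u} (G : SimpleGraph V) : Setoid {S : Set V // IsAsymmetrizing G S} where
  r S S' := Equivalent G G S.1 S'.1
  iseqv :=
    { refl := fun S => ⟨RelIso.refl G.Adj, by simp⟩
      symm := by
        rintro ⟨S, hS⟩ ⟨S', hS'⟩ ⟨φ, h⟩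
        refine ⟨φ.symm, ?_⟩
        change φ '' S = S' at h
        subst h
        ext x
        simp
      trans := by
        rintro ⟨S, hS⟩ ⟨S', hS'⟩ ⟨S'', hS''⟩ ⟨φ, h⟩ ⟨ψ, h'⟩
        refine ⟨φ.trans ψ, ?_⟩
        change φ '' S = S' at h
        change ψ '' S' = S'' at h'
        subst h
        subst h'
        ext x
        simp }

/-- The asymmetrizing number `a(G)`: the number (a cardinal) of equivalence classes of
asymmetrizing sets of `G`. -/
noncomputable def asymmetrizingNumber {V : Type u} (G : SimpleGraph V) : Cardinal.{u} :=
  #(Quotient (asymSetoid G))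

/-- The motion of `G` is at least `m`: every non-identity automorphism of `G` moves at least `m`
vertices.  For an asymmetric graph this holds for all `m`: the motion of such a graph is, by
convention, larger than every cardinal. -/
def MotionAtLeast {V : Type u} (G : SimpleGraph V) (m : Cardinal.{u}) : Prop :=
  ∀ φ : G ≃g G, φ ≠ RelIso.refl G.Adj → m ≤ #{v : V // φ v ≠ v}

end AsymTree

-- If $|T| < m$, the only automorphism is the identity. Otherwise root $T$. Exchanging two
-- isomorphic sibling branches is an automorphism, so such branches have size at least $m$, and
-- there are at most $2^m$ of them at a vertex. A set breaks every automorphism fixing the root as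
-- soon as siblings always carry non-isomorphic coloured branches. The task is thus to show that
-- branches have enough isomorphism types of colourings.
--
-- For a good vertex this is a well-founded induction (`Good.plentiful`): a branch with $\kappa$
-- vertices besides its apex has at least $2^\kappa$ types of rigid colourings for either colour of
-- the apex. It works because a class of isomorphic sibling branches of size $\kappa \ge m$ consumes
-- only $2^m \cdot 2^\kappa = 2^\kappa$ types.
--
-- Above a vertex that is not good ("bad") there is no such induction. There one counts auxiliary
-- colourings, rigid or not. Below any bad vertex choose a bad $x_0$ with the least number $\nu$ of
-- types. All bad descendants of $x_0$ then have exactly $\nu$ types. By Cantor's theorem a class of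
-- isomorphic bad siblings has at most $\nu$ members, so these can receive disjoint sets of $\nu$
-- types. Hence $\nu^k \le \nu$ for the number $k$ of bad children, and then for the size of every
-- layer of bad descendants (`Palette.exists_forall_layer`). The weights of the layers account, up
-- to a factor $\aleph_0$, for the whole branch, which has size at least $m$. So a sequence of
-- independent auxiliary colourings has at least $2^m$ combinations of types (`le_mk_pi_types`),
-- enough to separate all bad siblings.
--
-- One set encodes countably many auxiliary colourings (`Admissible.exists_aux_eq`): the levels are
-- split into infinitely many infinite classes, and the set of types occurring on the good children
-- of a bad vertex is decoded into a sequence of sets. One auxiliary colouring is left free and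
-- yields $2^{|T|}$ sets; one carries an aperiodic pattern; the others separate siblings
-- (`Admissible.exists_family`).
--
-- It remains to exclude automorphisms that move the root. If the tree is good, ranks of darts give
-- a centre, a vertex that is fixed or flipped along an edge (`exists_center`), and colours at the
-- centre forbid the flip. If not, the aperiodic pattern forbids changing levels along rays of bad
-- vertices (`eventually_same_level`). Inequivalence under the stabilizer of the root suffices for
-- the count, since the root has only $|T| < 2^{|T|}$ possible images.

universe v

/-! ### Rooted trees, isomorphisms of branches, types of coloured branches -/

namespace AsymTree

/-- A rooted tree, given by its parent function and its level function. -/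
structure Rooted (V : Type u) where
  root : V
  par : V → V
  lev : V → ℕ
  par_root : par root = root
  lev_root : lev root = 0
  lev_eq : ∀ x, x ≠ root → lev x = lev (par x) + 1

namespace Rooted

variable {V : Type u} {X : Type v} (D : Rooted V)

/-- The branch at `x`: all descendants of `x`, including `x`. -/
def below (x : V) : Set V := {y | ∃ n : ℕ, D.par^[n] y = x}

/-- The ancestor of `y` on level `n`. -/
def anc (n : ℕ) (y : V) : V := D.par^[D.lev y - n] y

def IsChild (z y : V) : Prop := z ≠ D.root ∧ D.par z = y

theorem lev_par (x : V) : D.lev (D.par x) = D.lev x - 1 := by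
  by_cases h : x = D.root
  · subst h; rw [D.par_root, D.lev_root]
  · rw [D.lev_eq x h]; simp

theorem lev_eq_zero {x : V} : D.lev x = 0 ↔ x = D.root := by
  constructor
  · intro h
    by_contra hx
    have := D.lev_eq x hx
    omega
  · rintro rfl
    exact D.lev_root

theorem lev_iterate (n : ℕ) (x : V) : D.lev (D.par^[n] x) = D.lev x - n := by
  induction n with
  | zero => simp
  | succ n ih => rw [Function.iterate_succ_apply', lev_par, ih]; omega

theorem lev_anc {n : ℕ} {y : V} (h : n ≤ D.lev y) : D.lev (D.anc n y) = n := by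
  rw [anc, lev_iterate]; omega

theorem anc_par {n : ℕ} {y : V} (h : n < D.lev y) : D.anc n (D.par y) = D.anc n y := by
  rw [anc, anc, lev_par, ← Function.iterate_succ_apply]
  congr 2
  omega

@[simp] theorem anc_lev (y : V) : D.anc (D.lev y) y = y := by simp [anc]

theorem anc_anc {k n : ℕ} {y : V} (hk : k ≤ n) (hn : n ≤ D.lev y) :
    D.anc k (D.anc n y) = D.anc k y := by
  rw [anc, D.lev_anc hn, anc, anc, ← Function.iterate_add_apply]
  congr 2
  omega

theorem anc_mem (n : ℕ) (y : V) : y ∈ D.below (D.anc n y) := ⟨_, rfl⟩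

theorem self_mem (x : V) : x ∈ D.below x := ⟨0, rfl⟩

theorem iterate_root (n : ℕ) : D.par^[n] D.root = D.root := by
  induction n with
  | zero => rfl
  | succ n ih => rw [Function.iterate_succ_apply, D.par_root, ih]

theorem mem_below_iff {x y : V} : y ∈ D.below x ↔ D.lev x ≤ D.lev y ∧ D.anc (D.lev x) y = x := by
  constructor
  · rintro ⟨n, rfl⟩
    rw [lev_iterate]
    refine ⟨by omega, ?_⟩
    rw [anc]
    rcases le_total n (D.lev y) with h | h
    · congr 2; omega
    · have h0 : D.par^[D.lev y] y = D.root := by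
        rw [← lev_eq_zero, lev_iterate]; omega
      have h1 : n = (n - D.lev y) + D.lev y := by omega
      have h2 : D.lev y - (D.lev y - n) = D.lev y := by omega
      rw [h2, h0, h1, Function.iterate_add_apply, h0, iterate_root]
  · rintro ⟨_, h⟩
    exact ⟨_, h⟩

theorem lev_le {x y : V} (h : y ∈ D.below x) : D.lev x ≤ D.lev y := (D.mem_below_iff.1 h).1

theorem anc_of_mem {x y : V} (h : y ∈ D.below x) : D.anc (D.lev x) y = x := (D.mem_below_iff.1 h).2

theorem eq_of_mem_of_mem {x x' y : V} (h : y ∈ D.below x) (h' : y ∈ D.below x')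
    (hl : D.lev x = D.lev x') : x = x' := by
  rw [← D.anc_of_mem h, ← D.anc_of_mem h', hl]

theorem mem_trans {x y z : V} (h : z ∈ D.below y) (h' : y ∈ D.below x) : z ∈ D.below x := by
  obtain ⟨n, rfl⟩ := h
  obtain ⟨k, rfl⟩ := h'
  exact ⟨k + n, Function.iterate_add_apply _ _ _ _⟩

theorem below_subset {x y : V} (h : y ∈ D.below x) : D.below y ⊆ D.below x :=
  fun _ hz => D.mem_trans hz h

theorem mem_par (x : V) : x ∈ D.below (D.par x) := ⟨1, rfl⟩

theorem mem_root (x : V) : x ∈ D.below D.root :=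
  ⟨D.lev x, by rw [← lev_eq_zero, lev_iterate]; omega⟩

theorem below_root : D.below D.root = Set.univ := Set.eq_univ_of_forall D.mem_root

theorem IsChild.lev {z y : V} (h : D.IsChild z y) : D.lev z = D.lev y + 1 := by
  rw [D.lev_eq z h.1, h.2]

theorem IsChild.mem {z y : V} (h : D.IsChild z y) : z ∈ D.below y := h.2 ▸ D.mem_par z

theorem IsChild.not_mem {z y : V} (h : D.IsChild z y) : y ∉ D.below z := fun h' => by
  have := D.lev_le h'
  have := IsChild.lev D h
  omega

theorem ne_root_of_mem {x y : V} (h : y ∈ D.below x) (hne : y ≠ x) : y ≠ D.root := by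
  rintro rfl
  have h1 := D.lev_le h
  rw [D.lev_root, Nat.le_zero, lev_eq_zero] at h1
  exact hne h1.symm

theorem lev_lt {x y : V} (h : y ∈ D.below x) (hne : y ≠ x) : D.lev x < D.lev y := by
  refine lt_of_le_of_ne (D.lev_le h) fun hl => hne ?_
  have := D.anc_of_mem h
  rwa [hl, anc_lev] at this

theorem par_mem {x y : V} (h : y ∈ D.below x) (hne : y ≠ x) : D.par y ∈ D.below x := by
  have hl := D.lev_lt h hne
  rw [mem_below_iff, D.anc_par hl, lev_par]
  exact ⟨by omega, D.anc_of_mem h⟩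

theorem isChild_par {x y : V} (h : y ∈ D.below x) (hne : y ≠ x) : D.IsChild y (D.par y) :=
  ⟨D.ne_root_of_mem h hne, rfl⟩

/-- The child of `y` above which `w` lies. -/
theorem isChild_anc {y w : V} (h : w ∈ D.below y) (hne : w ≠ y) :
    D.IsChild (D.anc (D.lev y + 1) w) y := by
  have hl := D.lev_lt h hne
  have h1 := D.lev_anc (n := D.lev y + 1) (y := w) hl
  constructor
  · rw [Ne, ← lev_eq_zero, h1]; omega
  · have h2 : D.anc (D.lev y) (D.anc (D.lev y + 1) w) = y := by
      rw [D.anc_anc (by omega) hl, D.anc_of_mem h]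
    rw [anc, h1, show D.lev y + 1 - D.lev y = 1 by omega] at h2
    exact h2

theorem anc_eq_of_isChild {y z w : V} (h : D.IsChild z y) (hw : w ∈ D.below z) :
    D.anc (D.lev y + 1) w = z := by
  rw [← IsChild.lev D h, D.anc_of_mem hw]

theorem ne_of_mem_child {y z w : V} (h : D.IsChild z y) (hw : w ∈ D.below z) : w ≠ y := by
  rintro rfl
  exact IsChild.not_mem D h hw

theorem child_eq_of_mem {y z z' w : V} (h : D.IsChild z y) (h' : D.IsChild z' y)
    (hw : w ∈ D.below z) (hw' : w ∈ D.below z') : z = z' :=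
  D.eq_of_mem_of_mem hw hw' (by rw [IsChild.lev D h', IsChild.lev D h])

/-- `e` and `e'` are mutually inverse isomorphisms between the branches at `x` and at `x'`. -/
structure IsIso (e e' : V → V) (x x' : V) : Prop where
  maps : ∀ y ∈ D.below x, e y ∈ D.below x'
  maps' : ∀ y ∈ D.below x', e' y ∈ D.below x
  inv : ∀ y ∈ D.below x, e' (e y) = y
  inv' : ∀ y ∈ D.below x', e (e' y) = y
  apex : e x = x'
  par : ∀ y ∈ D.below x, y ≠ x → D.par (e y) = e (D.par y)
  lev : ∀ y ∈ D.below x, D.lev (e y) = D.lev y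

variable {D}

namespace IsIso

variable {e e' f f' : V → V} {x y z : V}

theorem refl (x : V) : D.IsIso id id x x := by
  constructor <;> simp

theorem ne_apex (h : D.IsIso e e' x y) {w : V} (hw : w ∈ D.below x) (hne : w ≠ x) : e w ≠ y := by
  intro hc
  apply hne
  rw [← h.inv w hw, hc, ← h.apex, h.inv x (D.self_mem x)]

theorem apex' (h : D.IsIso e e' x y) : e' y = x := by
  rw [← h.apex, h.inv x (D.self_mem x)]

theorem symm (h : D.IsIso e e' x y) : D.IsIso e' e y x where
  maps := h.maps'
  maps' := h.maps
  inv := h.inv'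
  inv' := h.inv
  apex := h.apex'
  par w hw hne := by
    have h1 := h.maps' w hw
    have h2 : e' w ≠ x := by
      intro hc
      apply hne
      rw [← h.inv' w hw, hc, h.apex]
    have h3 := h.par _ h1 h2
    rw [h.inv' w hw] at h3
    rw [h3, h.inv _ (D.par_mem h1 h2)]
  lev w hw := by
    rw [← h.lev _ (h.maps' w hw), h.inv' w hw]

theorem trans (h : D.IsIso e e' x y) (h' : D.IsIso f f' y z) :
    D.IsIso (f ∘ e) (e' ∘ f') x z where
  maps w hw := h'.maps _ (h.maps _ hw)
  maps' w hw := h.maps' _ (h'.maps' _ hw)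
  inv w hw := by simp [h'.inv _ (h.maps _ hw), h.inv _ hw]
  inv' w hw := by simp [h.inv' _ (h'.maps' _ hw), h'.inv' _ hw]
  apex := by simp [h.apex, h'.apex]
  par w hw hne := by
    simp only [Function.comp]
    rw [h'.par _ (h.maps _ hw) (h.ne_apex hw hne), h.par _ hw hne]
  lev w hw := by simp [h'.lev _ (h.maps _ hw), h.lev _ hw]

theorem maps_below (h : D.IsIso e e' x y) {w v : V} (hw : w ∈ D.below x) (hv : v ∈ D.below w) :
    e v ∈ D.below (e w) := by
  have key : ∀ n : ℕ, ∀ v ∈ D.below w, D.lev v = D.lev w + n → e v ∈ D.below (e w) := by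
    intro n
    induction n with
    | zero =>
      intro v hv hl
      by_cases hne : v = w
      · subst hne; exact D.self_mem _
      · have := D.lev_lt hv hne; omega
    | succ n ih =>
      intro v hv hl
      have hne : v ≠ w := by rintro rfl; omega
      have hvx := D.mem_trans hv hw
      have hne' : v ≠ x := by
        rintro rfl
        have := D.lev_le hw
        omega
      have h1 := ih (D.par v) (D.par_mem hv hne) (by rw [lev_par]; omega)
      rw [← h.par v hvx hne'] at h1
      exact D.mem_trans (D.mem_par _) h1
  exact key (D.lev v - D.lev w) v hv (by have := D.lev_le hv; omega)

theorem restrict (h : D.IsIso e e' x y) {w : V} (hw : w ∈ D.below x) :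
    D.IsIso e e' w (e w) where
  maps v hv := h.maps_below hw hv
  maps' v hv := by
    have := h.symm.maps_below (h.maps w hw) hv
    rwa [h.inv w hw] at this
  inv v hv := h.inv v (D.mem_trans hv hw)
  inv' v hv := h.inv' v (D.mem_trans hv (h.maps w hw))
  apex := rfl
  par v hv hne := by
    refine h.par v (D.mem_trans hv hw) ?_
    rintro rfl
    have := D.lev_lt hv hne
    have := D.lev_le hw
    omega
  lev v hv := h.lev v (D.mem_trans hv hw)

theorem isChild (h : D.IsIso e e' x y) {z w : V} (hw : w ∈ D.below x) (hz : D.IsChild z w) :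
    D.IsChild (e z) (e w) := by
  have hzx := D.mem_trans (IsChild.mem D hz) hw
  have hne : z ≠ x := by
    rintro rfl
    have := D.lev_le hw
    have := IsChild.lev D hz
    omega
  refine ⟨D.ne_root_of_mem (h.maps z hzx) (h.ne_apex hzx hne), ?_⟩
  rw [h.par z hzx hne, hz.2]

theorem mk_below (h : D.IsIso e e' x y) : #(D.below x) = #(D.below y) :=
  Cardinal.mk_congr
    { toFun := fun w => ⟨e w, h.maps w w.2⟩
      invFun := fun w => ⟨e' w, h.maps' w w.2⟩
      left_inv := fun w => Subtype.ext (h.inv w w.2)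
      right_inv := fun w => Subtype.ext (h.inv' w w.2) }

theorem eq_of_fixes_steps (h : D.IsIso e e' x x)
    (hs : ∀ y ∈ D.below x, y ≠ x → e (D.par y) = D.par y → e y = y) :
    ∀ y ∈ D.below x, e y = y := by
  have key : ∀ n : ℕ, ∀ y ∈ D.below x, D.lev y = n → e y = y := by
    intro n
    induction n with
    | zero =>
      intro y hy hl
      by_cases hne : y = x
      · subst hne; exact h.apex
      · have := D.lev_lt hy hne; omega
    | succ n ih =>
      intro y hy hl
      by_cases hne : y = x
      · subst hne; exact h.apex
      · exact hs y hy hne (ih _ (D.par_mem hy hne) (by rw [lev_par]; omega))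
  exact fun y hy => key _ y hy rfl

end IsIso

variable (D)

/-- Isomorphism of coloured branches. -/
def Sim (p q : V × (V → X)) : Prop :=
  ∃ e e', D.IsIso e e' p.1 q.1 ∧ ∀ y ∈ D.below p.1, q.2 (e y) = p.2 y

/-- Isomorphism of branches. -/
def Rel (x y : V) : Prop := ∃ e e', D.IsIso e e' x y

theorem Rel.refl (x : V) : D.Rel x x := ⟨_, _, IsIso.refl x⟩

variable {D} in
theorem Rel.symm {x y : V} : D.Rel x y → D.Rel y x := fun ⟨_, _, h⟩ => ⟨_, _, h.symm⟩

variable {D} in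
theorem Rel.trans {x y z : V} : D.Rel x y → D.Rel y z → D.Rel x z :=
  fun ⟨_, _, h⟩ ⟨_, _, h'⟩ => ⟨_, _, h.trans h'⟩

def typeSetoid (X : Type v) : Setoid (V × (V → X)) where
  r := D.Sim
  iseqv :=
    { refl := fun p => ⟨_, _, IsIso.refl _, fun _ _ => rfl⟩
      symm := by
        rintro p q ⟨e, e', h, hc⟩
        refine ⟨_, _, h.symm, fun y hy => ?_⟩
        rw [← hc _ (h.maps' y hy), h.inv' y hy]
      trans := by
        rintro p q r ⟨e, e', h, hc⟩ ⟨f, f', h', hc'⟩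
        refine ⟨_, _, h.trans h', fun y hy => ?_⟩
        rw [← hc y hy, ← hc' _ (h.maps y hy), Function.comp] }

/-- Isomorphism types of branches coloured with colours from `X`. -/
abbrev BType (X : Type v) : Type (max u v) := Quotient (D.typeSetoid X)

def ty (x : V) (c : V → X) : D.BType X := Quotient.mk (D.typeSetoid X) (x, c)

theorem ty_eq_iff {x y : V} {c d : V → X} :
    D.ty x c = D.ty y d ↔ ∃ e e', D.IsIso e e' x y ∧ ∀ w ∈ D.below x, d (e w) = c w :=
  ⟨fun h => Quotient.exact h, fun h => Quotient.sound h⟩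

theorem ty_congr {x : V} {c d : V → X} (h : ∀ w ∈ D.below x, c w = d w) : D.ty x c = D.ty x d :=
  D.ty_eq_iff.2 ⟨_, _, IsIso.refl x, fun w hw => (h w hw).symm⟩

variable {D} in
theorem rel_of_ty_eq {x y : V} {c d : V → X} (h : D.ty x c = D.ty y d) : D.Rel x y := by
  obtain ⟨e, e', h, _⟩ := D.ty_eq_iff.1 h
  exact ⟨e, e', h⟩

theorem IsIso.ty_eq {e e' : V → V} {x y : V} (h : D.IsIso e e' x y) (c : V → X) :
    D.ty y (c ∘ e') = D.ty x c :=
  (D.ty_eq_iff.2 ⟨e, e', h, fun w hw => by simp [h.inv w hw]⟩).symm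

theorem apex_color_eq {x y : V} {c d : V → X} (h : D.ty x c = D.ty y d) : c x = d y := by
  obtain ⟨e, e', h, hc⟩ := D.ty_eq_iff.1 h
  rw [← hc x (D.self_mem x), h.apex]

/-- The coloured branch at `x` has no non-identity automorphism. -/
def Rigid (x : V) (c : V → X) : Prop :=
  ∀ e e', D.IsIso e e' x x → (∀ y ∈ D.below x, c (e y) = c y) → ∀ y ∈ D.below x, e y = y

variable {D} in
theorem Rigid.of_ty_eq {x y : V} {c d : V → X} (hr : D.Rigid x c) (h : D.ty x c = D.ty y d) :
    D.Rigid y d := by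
  obtain ⟨e, e', h, hc⟩ := D.ty_eq_iff.1 h
  intro f f' hf hd w hw
  have h1 := hr _ _ ((h.trans hf).trans h.symm) (by
    intro v hv
    simp only [Function.comp]
    have h2 := h.maps v hv
    have h3 := hf.maps _ h2
    rw [← hc v hv, ← hd _ h2, ← hc _ (h.maps' _ h3), h.inv' _ h3]) (e' w) (h.maps' w hw)
  simp only [Function.comp] at h1
  rw [h.inv' w hw] at h1
  have h2 := congrArg e h1
  rwa [h.inv' _ (hf.maps w hw), h.inv' w hw] at h2

/-- `x` is good with respect to `m` if there is no infinite descending path of branches of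
size at least `m` starting below `x`. -/
def Good (m : Cardinal.{u}) (x : V) : Prop :=
  Acc (fun z y => D.IsChild z y ∧ m ≤ #(D.below z)) x

variable {D} {m : Cardinal.{u}}

theorem Good.of_isIso {x : V} (h : D.Good m x) :
    ∀ {y : V} {e e' : V → V}, D.IsIso e e' x y → D.Good m y := by
  induction h with
  | intro x _ ih =>
    intro y e e' hi
    constructor
    rintro z ⟨hz, hm⟩
    have hc := hi.symm.isChild (D.self_mem y) hz
    rw [hi.apex'] at hc
    have hr := hi.restrict (IsChild.mem D hc)
    rw [hi.inv' z (IsChild.mem D hz)] at hr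
    exact ih (e' z) ⟨hc, by rwa [hr.mk_below]⟩ hr

theorem Good.of_rel {x y : V} (h : D.Good m x) (hr : D.Rel x y) : D.Good m y := by
  obtain ⟨e, e', hr⟩ := hr
  exact h.of_isIso hr

theorem good_of_small {x : V} (h : #(D.below x) < m) : D.Good m x := by
  constructor
  rintro z ⟨hz, hm⟩
  exact absurd (hm.trans (Cardinal.mk_le_mk_of_subset (D.below_subset (IsChild.mem D hz)))) h.not_ge

theorem Good.child {x z : V} (h : D.Good m x) (hz : D.IsChild z x) : D.Good m z := by
  by_cases hm : m ≤ #(D.below z)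
  · exact h.inv ⟨hz, hm⟩
  · exact good_of_small (not_le.1 hm)

theorem good_of_children {x : V} (h : ∀ z, D.IsChild z x → D.Good m z) : D.Good m x :=
  ⟨_, fun z hz => h z hz.1⟩

theorem Good.of_mem {x : V} (h : D.Good m x) {y : V} (hy : y ∈ D.below x) : D.Good m y := by
  obtain ⟨n, rfl⟩ := hy
  induction n generalizing y with
  | zero => exact h
  | succ n ih =>
    rw [Function.iterate_succ_apply] at h
    have h1 := ih h
    by_cases hr : y = D.root
    · subst hr
      rwa [D.par_root] at h1
    · exact h1.child ⟨hr, rfl⟩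

theorem exists_child_not_good {x : V} (h : ¬ D.Good m x) : ∃ z, D.IsChild z x ∧ ¬ D.Good m z := by
  by_contra! hc
  exact h (good_of_children hc)

theorem big_of_not_good {x : V} (h : ¬ D.Good m x) : m ≤ #(D.below x) := by
  by_contra! hc
  exact h (good_of_small hc)

theorem not_good_of_mem {x y : V} (h : ¬ D.Good m y) (hy : y ∈ D.below x) : ¬ D.Good m x :=
  fun hx => h (hx.of_mem hy)

variable (D m) in
/-- Infinite cardinal `m`, degrees at most `2 ^ m`, and isomorphic sibling branches have size
at least `m`. -/
structure Admissible : Prop where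
  infinite : ℵ₀ ≤ m
  deg : ∀ y, #{z // D.IsChild z y} ≤ 2 ^ m
  motion : ∀ y z z', D.IsChild z y → D.IsChild z' y → z ≠ z' → D.Rel z z' → m ≤ #(D.below z)

/-- A lowest moved vertex goes to a sibling with an isomorphic branch, and that branch would have
size at least `m`. -/
theorem Admissible.rigid_of_small (hD : D.Admissible m) {x : V} (hx : #(D.below x) < m)
    (c : V → X) : D.Rigid x c := by
  intro e e' h _
  apply h.eq_of_fixes_steps
  intro y hy hne hp
  by_contra hc
  have h1 := D.isChild_par hy hne
  have h2 := h.isChild (D.par_mem hy hne) h1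
  rw [hp] at h2
  have h3 := hD.motion _ y (e y) h1 h2 (Ne.symm hc) ⟨_, _, h.restrict hy⟩
  exact absurd (h3.trans (Cardinal.mk_le_mk_of_subset (D.below_subset hy))) hx.not_ge

/-- If the colours split the children of `x` into pairwise different types, each of which is rigid,
then the branch at `x` is rigid. -/
theorem rigid_of_children {x : V} {c : V → X}
    (hinj : ∀ z z', D.IsChild z x → D.IsChild z' x → D.ty z c = D.ty z' c → z = z')
    (hr : ∀ z, D.IsChild z x → D.Rigid z c) : D.Rigid x c := by
  intro e e' h hc y hy
  by_cases hne : y = x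
  · subst hne; exact h.apex
  have hz := D.isChild_anc hy hne
  set z := D.anc (D.lev x + 1) y with hzdef
  have hyz : y ∈ D.below z := D.anc_mem _ _
  have hzx := IsChild.mem D hz
  have hres := h.restrict hzx
  have hez : e z = z := by
    have h2 := h.isChild (D.self_mem x) hz
    rw [h.apex] at h2
    refine (hinj _ _ hz h2 (D.ty_eq_iff.2 ⟨e, e', hres, fun w hw => hc w (D.mem_trans hw hzx)⟩)).symm
  rw [hez] at hres
  exact hr z hz e e' hres (fun w hw => hc w (D.mem_trans hw hzx)) y hyz

end Rooted
end AsymTree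

/-! ### Good vertices: counting rigid colourings -/

namespace AsymTree

/-- Inequivalent indices have disjoint supplies `A`, so it suffices to embed, for one representative
of each class, the disjoint union of all demands `B` of the class into the common supply. This is
how siblings receive pairwise different types. -/
theorem exists_disjoint_selection {Z Q Y : Type u} [Nonempty Q] (s : Setoid Z) (A : Z → Set Q)
    (B : Z → Set Y) (hA : ∀ z z', s z z' → A z = A z')
    (hdis : ∀ z z' q, q ∈ A z → q ∈ A z' → s z z')
    (hcard : ∀ z, Cardinal.sum (fun z' : {z' // s z z'} => #(B z')) ≤ #(A z)) :
    ∃ ι : Z → Y → Q, (∀ z, ∀ b ∈ B z, ι z b ∈ A z) ∧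
      ∀ z z', ∀ b ∈ B z, ∀ b' ∈ B z', ι z b = ι z' b' → z = z' ∧ b = b' := by
  classical
  have hg : ∀ z, Nonempty ((Σ z' : {z' // s z z'}, B z') ↪ A z) := fun z => by
    rw [← Cardinal.le_def, Cardinal.mk_sigma]
    exact hcard z
  let rep : Z → Z := fun z => (Quotient.mk s z).out
  have hrep : ∀ z, s (rep z) z := fun z => Quotient.exact (Quotient.out_eq (Quotient.mk s z))
  refine ⟨fun z b => if hb : b ∈ B z then (hg (rep z)).some ⟨⟨z, hrep z⟩, ⟨b, hb⟩⟩
    else Classical.arbitrary Q, ?_, ?_⟩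
  · intro z b hb
    simp only [hb, dite_true]
    rw [← hA _ _ (hrep z)]
    exact Subtype.prop _
  · intro z z' b hb b' hb' h
    simp only [hb, hb', dite_true] at h
    have h1 : s z z' := by
      have h2 := hdis (rep z) (rep z') _ (Subtype.prop _) (h.symm ▸ Subtype.prop _)
      exact s.trans (s.symm (hrep z)) (s.trans h2 (hrep z'))
    have h3 : rep z = rep z' := by
      simp only [rep]
      rw [Quotient.sound h1]
    have key : ∀ r r' : Z, ∀ hr : s r z, ∀ hr' : s r' z', r = r' →
        ((hg r).some ⟨⟨z, hr⟩, ⟨b, hb⟩⟩ : Q) = (hg r').some ⟨⟨z', hr'⟩, ⟨b', hb'⟩⟩ →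
          z = z' ∧ b = b' := by
      rintro r _ hr hr' rfl he
      have := (hg r).some.injective (Subtype.ext he)
      rw [Sigma.mk.injEq] at this
      obtain ⟨h4, h5⟩ := this
      have h6 : z = z' := congrArg Subtype.val h4
      subst h6
      exact ⟨rfl, congrArg Subtype.val (eq_of_heq h5)⟩
    exact key _ _ _ _ h3 h

namespace Rooted

variable {V : Type u} {X : Type v} {D : Rooted V} {m : Cardinal.{u}}

variable (D) in
theorem exists_glue (y : V) (a : X) (g : V → V → X) :
    ∃ c : V → X, c y = a ∧ ∀ z, D.IsChild z y → ∀ w ∈ D.below z, c w = g z w := by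
  classical
  refine ⟨fun w => if w = y then a else g (D.anc (D.lev y + 1) w) w, by simp, ?_⟩
  intro z hz w hw
  have h1 := D.ne_of_mem_child hz hw
  simp only [h1, if_false, D.anc_eq_of_isChild hz hw]

variable (D) in
/-- The children of `y` that satisfy `p`. -/
def kids (p : V → Prop) (y : V) : Set V := {z | D.IsChild z y ∧ p z}

/-- An isomorphism may permute children, so the unordered set of child types is the information that
survives in the type of the parent. All lower bounds on numbers of types recover their data from
this set. -/
theorem image_kids_eq {p : V → Prop} (hp : ∀ z z', D.Rel z z' → p z → p z') {y y' : V}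
    {c c' : V → X} (h : D.ty y c = D.ty y' c') :
    (fun z => D.ty z c) '' D.kids p y = (fun z => D.ty z c') '' D.kids p y' := by
  have key : ∀ (y y' : V) (c c' : V → X), D.ty y c = D.ty y' c' →
      (fun z => D.ty z c) '' D.kids p y ⊆ (fun z => D.ty z c') '' D.kids p y' := by
    rintro y y' c c' h _ ⟨z, ⟨hz, hpz⟩, rfl⟩
    obtain ⟨e, e', he, hc⟩ := D.ty_eq_iff.1 h
    have hzy := IsChild.mem D hz
    have h1 := he.isChild (D.self_mem y) hz
    rw [he.apex] at h1
    refine ⟨e z, ⟨h1, hp _ _ ⟨_, _, he.restrict hzy⟩ hpz⟩, ?_⟩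
    exact (D.ty_eq_iff.2 ⟨e, e', he.restrict hzy, fun w hw => hc w (D.mem_trans hw hzy)⟩).symm
  exact (key _ _ _ _ h).antisymm (key _ _ _ _ h.symm)

variable (D) in
/-- Types of rigid colourings of the branch at `z` where `z` gets the colour `b`. -/
def rigidTypes (z : V) (b : Prop) : Set (D.BType Prop) :=
  {q | ∃ c : V → Prop, D.Rigid z c ∧ (c z ↔ b) ∧ D.ty z c = q}

variable (D) in
/-- Types of rigid colourings of the branch at `z` where `z` gets the colour `b` if the branch is
infinite. -/
def fam (z : V) (b : Prop) : Set (D.BType Prop) :=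
  {q | ∃ c : V → Prop, D.Rigid z c ∧ (ℵ₀ ≤ #(D.below z) → (c z ↔ b)) ∧ D.ty z c = q}

variable (D) in
/-- The branch at `z` has the largest possible number of types of rigid colourings. -/
def Plentiful (z : V) : Prop :=
  ∀ b : Prop, 2 ^ #(D.below z \ {z} : Set V) ≤ #(D.rigidTypes z b)

theorem mk_below_eq (z : V) : #(D.below z) = #(D.below z \ {z} : Set V) + 1 := by
  rw [← Cardinal.mk_sdiff_add_mk (Set.singleton_subset_iff.2 (D.self_mem z)), Cardinal.mk_singleton]

/-- In an infinite branch the apex does not affect the cardinality, so its colour can be prescribed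
for free. In a finite one both colours of the apex are needed to gain the missing factor 2; this is
why `fam` prescribes a colour for infinite branches only. -/
theorem Plentiful.le_fam {z : V} (h : D.Plentiful z) (b : Prop) :
    2 ^ #(D.below z) ≤ #(D.fam z b) := by
  rcases le_or_gt ℵ₀ #(D.below z) with hi | hf
  · have h1 : #(D.below z \ {z} : Set V) = #(D.below z) := by
      rw [mk_below_eq] at hi ⊢
      have h2 : ℵ₀ ≤ #(D.below z \ {z} : Set V) := by
        by_contra! hc
        exact absurd hi (Cardinal.add_lt_aleph0 hc Cardinal.one_lt_aleph0).not_ge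
      exact (Cardinal.add_one_eq h2).symm
    rw [← h1]
    refine (h b).trans (Cardinal.mk_le_mk_of_subset ?_)
    rintro q ⟨c, hr, hb, rfl⟩
    exact ⟨c, hr, fun _ => hb, rfl⟩
  · rw [mk_below_eq, Cardinal.power_add, Cardinal.power_one, mul_two]
    have hd : Disjoint (D.rigidTypes z True) (D.rigidTypes z False) := by
      rw [Set.disjoint_left]
      rintro _ ⟨c, _, hb, rfl⟩ ⟨c', _, hb', h⟩
      have := D.apex_color_eq h
      simp_all
    refine (add_le_add (h True) (h False)).trans ?_
    rw [← Cardinal.mk_union_of_disjoint hd]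
    refine Cardinal.mk_le_mk_of_subset ?_
    rintro q (⟨c, hr, hb, rfl⟩ | ⟨c, hr, hb, rfl⟩) <;>
    exact ⟨c, hr, fun h => absurd h hf.not_ge, rfl⟩

theorem fam_eq_of_rel {z z' : V} (h : D.Rel z z') (b : Prop) : D.fam z b = D.fam z' b := by
  have key : ∀ z z' : V, D.Rel z z' → D.fam z b ⊆ D.fam z' b := by
    rintro z z' ⟨e, e', he⟩ _ ⟨c, hr, hb, rfl⟩
    have h1 := IsIso.ty_eq D he c
    refine ⟨c ∘ e', hr.of_ty_eq h1.symm, fun hi => ?_, h1⟩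
    rw [Function.comp, he.apex']
    exact hb (by rwa [he.mk_below])
  exact (key _ _ h).antisymm (key _ _ h.symm)

theorem rel_of_mem_fam {z z' : V} {b b' : Prop} {q} (h : q ∈ D.fam z b) (h' : q ∈ D.fam z' b') :
    D.Rel z z' := by
  obtain ⟨c, _, _, rfl⟩ := h
  obtain ⟨c', _, _, h⟩ := h'
  exact rel_of_ty_eq h.symm

variable (D) in
def relSetoid (Z : Set V) : Setoid Z where
  r z z' := D.Rel z z'
  iseqv := ⟨fun z => Rel.refl D z, Rel.symm, Rel.trans⟩

instance : Nonempty (D.BType Prop) := ⟨D.ty D.root fun _ => True⟩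

variable (D) in
/-- Sets of types that can occur on the set `Z` of siblings when the types are pairwise
different. -/
def patterns (Z : Set V) (b : Prop) : Set (Set (D.BType Prop)) :=
  {P | ∃ f : V → D.BType Prop, Set.InjOn f Z ∧ (∀ z ∈ Z, f z ∈ D.fam z b) ∧ f '' Z = P}

theorem Admissible.mk_class_le (hD : D.Admissible m) {y : V} {Z : Set V}
    (hZ : ∀ z ∈ Z, D.IsChild z y) (z : Z) :
    #{z' // D.relSetoid Z z z'} = 1 ∨
      m ≤ #(D.below z) ∧ #{z' // D.relSetoid Z z z'} ≤ 2 ^ m := by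
  by_cases hc : ∃ z' : Z, z' ≠ z ∧ D.Rel z z'
  · obtain ⟨z', hne, hr⟩ := hc
    refine Or.inr ⟨hD.motion y z z' (hZ _ z.2) (hZ _ z'.2) (fun h => hne (Subtype.ext h.symm)) hr,
      le_trans ?_ (hD.deg y)⟩
    exact ⟨⟨fun w => ⟨w.1, hZ _ w.1.2⟩, fun w w' h =>
      Subtype.ext (Subtype.ext (Subtype.mk.inj h))⟩⟩
  · push Not at hc
    left
    rw [Cardinal.eq_one_iff_unique]
    refine ⟨⟨fun w w' => ?_⟩, ⟨⟨z, Rel.refl D _⟩⟩⟩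
    have h1 : w.1 = z := by
      by_contra hne
      exact hc _ hne w.2
    have h2 : w'.1 = z := by
      by_contra hne
      exact hc _ hne w'.2
    exact Subtype.ext (h1.trans h2.symm)

/-- Each sibling gets its own supply of types, indexed by the subsets of its branch. A subset of the
union of the branches is then encoded by the set of the types used, as a type reveals which sibling
it belongs to. -/
theorem Admissible.le_mk_patterns (hD : D.Admissible m) {y : V} {Z : Set V}
    (hZ : ∀ z ∈ Z, D.IsChild z y) (hp : ∀ z ∈ Z, D.Plentiful z) (b : Prop) :
    2 ^ #(⋃ z ∈ Z, D.below z : Set V) ≤ #(D.patterns Z b) := by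
  obtain ⟨ι, h1, h2⟩ := exists_disjoint_selection (D.relSetoid Z) (fun z => D.fam z b)
    (fun z => 𝒫 (D.below z)) (fun z z' h => fam_eq_of_rel h b)
    (fun z z' q h h' => rel_of_mem_fam h h') (fun z => by
      have h3 : (fun z' : {z' // D.relSetoid Z z z'} => #(𝒫 (D.below z') : Set (Set V))) =
          fun _ => 2 ^ #(D.below z) := by
        funext z'
        obtain ⟨e, e', he⟩ := z'.2
        rw [Cardinal.mk_powerset, he.mk_below]
      rw [h3, Cardinal.sum_const']
      refine le_trans ?_ ((hp z z.2).le_fam b)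
      rcases hD.mk_class_le hZ z with h | ⟨hm, h⟩
      · rw [h, one_mul]
      -- At most $2^m$ isomorphic siblings, each demanding $2^{\kappa}$ types with $\kappa \ge m$,
      -- demand only $2^{\kappa}$ in total.
      · refine (mul_le_mul_left h _).trans ?_
        rw [← Cardinal.power_add, Cardinal.add_eq_right (hD.infinite.trans hm) hm])
  rw [← Cardinal.mk_set]
  have hmem : ∀ (z : Z) (h : Set (⋃ z ∈ Z, D.below z : Set V)),
      (Subtype.val '' h ∩ D.below z) ∈ 𝒫 (D.below z) := fun z h => Set.inter_subset_right
  classical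
  let F : Set (⋃ z ∈ Z, D.below z : Set V) → V → D.BType Prop := fun h z =>
    if hz : z ∈ Z then ι ⟨z, hz⟩ (Subtype.val '' h ∩ D.below z) else Classical.arbitrary _
  have hF : ∀ h, ∀ z (hz : z ∈ Z), F h z = ι ⟨z, hz⟩ (Subtype.val '' h ∩ D.below z) := by
    intro h z hz
    simp only [F, hz, dite_true]
  refine Cardinal.mk_le_of_injective (f := fun h => ⟨F h '' Z, F h, ?_, ?_, rfl⟩) ?_
  · intro z hz z' hz' he
    rw [hF _ _ hz, hF _ _ hz'] at he
    exact congrArg Subtype.val (h2 _ _ _ (hmem ⟨z, hz⟩ _) _ (hmem ⟨z', hz'⟩ _) he).1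
  · intro z hz
    rw [hF _ _ hz]
    exact h1 _ _ (hmem ⟨z, hz⟩ _)
  · intro h h' he
    have he : F h '' Z = F h' '' Z := congrArg Subtype.val he
    have key : ∀ z (hz : z ∈ Z), Subtype.val '' h ∩ D.below z = Subtype.val '' h' ∩ D.below z := by
      intro z hz
      have h3 : F h z ∈ F h' '' Z := he ▸ Set.mem_image_of_mem _ hz
      obtain ⟨z', hz', h4⟩ := h3
      rw [hF _ _ hz, hF _ _ hz'] at h4
      obtain ⟨h5, h6⟩ := h2 _ _ _ (hmem ⟨z', hz'⟩ _) _ (hmem ⟨z, hz⟩ _) h4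
      have h7 : z' = z := congrArg Subtype.val h5
      subst h7
      exact h6.symm
    ext ⟨w, hw⟩
    obtain ⟨z, hz, hwz⟩ := Set.mem_iUnion₂.1 hw
    have h8 := Set.ext_iff.1 (key z hz) w
    have hw' : ∃ i ∈ Z, w ∈ D.below i := ⟨z, hz, hwz⟩
    simpa [hwz, hw'] using h8

theorem exists_realization {Z : Set V} {b : Prop} {f : V → D.BType Prop}
    (hf : ∀ z ∈ Z, f z ∈ D.fam z b) : ∃ g : V → V → Prop, ∀ z ∈ Z, D.Rigid z (g z) ∧
      (ℵ₀ ≤ #(D.below z) → (g z z ↔ b)) ∧ D.ty z (g z) = f z := by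
  classical
  choose! g hg using hf
  exact ⟨g, hg⟩

/-- A branch with fewer than `m` vertices has only the identity as automorphism, so different
colourings have different types and all are rigid. -/
theorem Admissible.plentiful_of_small (hD : D.Admissible m) {x : V} (hx : #(D.below x) < m) :
    D.Plentiful x := by
  intro b
  rw [← Cardinal.mk_set]
  let c : Set (D.below x \ {x} : Set V) → V → Prop := fun h w =>
    (w = x ∧ b) ∨ w ∈ Subtype.val '' h
  refine Cardinal.mk_le_of_injective (f := fun h => ⟨D.ty x (c h), c h,
    hD.rigid_of_small hx _, ?_, rfl⟩) ?_
  · simp [c]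
  · intro h h' he
    have he : D.ty x (c h) = D.ty x (c h') := congrArg Subtype.val he
    obtain ⟨e, e', hi, hc⟩ := D.ty_eq_iff.1 he
    have hid := hD.rigid_of_small hx (fun _ => True) e e' hi (fun _ _ => rfl)
    ext ⟨w, hw⟩
    have h1 := hc w hw.1
    rw [hid w hw.1] at h1
    have hne : w ≠ x := hw.2
    have hw' : w ∈ D.below x := hw.1
    simpa [c, hne, hw'] using h1.symm

theorem diff_eq_iUnion (x : V) : D.below x \ {x} = ⋃ z ∈ {z | D.IsChild z x}, D.below z := by
  ext w
  simp only [Set.mem_sdiff, Set.mem_singleton_iff, Set.mem_iUnion, Set.mem_ofPred_eq, exists_prop]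
  constructor
  · rintro ⟨h, hne⟩
    exact ⟨_, D.isChild_anc h hne, D.anc_mem _ _⟩
  · rintro ⟨z, hz, hw⟩
    exact ⟨D.mem_trans hw (IsChild.mem D hz), D.ne_of_mem_child hz hw⟩

theorem kids_true (x : V) : D.kids (fun _ => True) x = {z | D.IsChild z x} := by
  simp [kids]

/-- Realize a pattern on the children: distinct rigid types on siblings make the branch rigid, and
the pattern is recovered from the type. The colours `b`, `b'` serve later to forbid that the root is
exchanged with a neighbour. -/
theorem Admissible.exists_coloring (hD : D.Admissible m) {x : V}
    (hp : ∀ z, D.IsChild z x → D.Plentiful z) (b b' : Prop) :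
    ∃ c : Set (D.below x \ {x} : Set V) → V → Prop, (∀ h, D.Rigid x (c h) ∧ (c h x ↔ b) ∧
      ∀ z, D.IsChild z x → ℵ₀ ≤ #(D.below z) → (c h z ↔ b')) ∧
      Function.Injective fun h => D.ty x (c h) := by
  have h0 := hD.le_mk_patterns (y := x) (Z := {z | D.IsChild z x}) (fun z hz => hz) hp b'
  rw [← diff_eq_iUnion, ← Cardinal.mk_set] at h0
  obtain ⟨P⟩ := h0
  have h1 : ∀ h, ∃ c : V → Prop, (D.Rigid x c ∧ (c x ↔ b) ∧
      ∀ z, D.IsChild z x → ℵ₀ ≤ #(D.below z) → (c z ↔ b')) ∧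
      (fun z => D.ty z c) '' {z | D.IsChild z x} = P h := by
    intro h
    obtain ⟨f, hinj, hf, hP⟩ := (P h).2
    obtain ⟨g, hg⟩ := exists_realization hf
    obtain ⟨c, hcx, hc⟩ := D.exists_glue x b g
    have hty : ∀ z, D.IsChild z x → D.ty z c = f z := fun z hz => by
      rw [← (hg z hz).2.2]
      exact D.ty_congr (hc z hz)
    refine ⟨c, ⟨?_, by rw [hcx], ?_⟩, ?_⟩
    · refine rigid_of_children (fun z z' hz hz' he => ?_) (fun z hz => ?_)
      · rw [hty z hz, hty z' hz'] at he
        exact hinj hz hz' he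
      · exact (hg z hz).1.of_ty_eq ((hg z hz).2.2.trans (hty z hz).symm)
    · intro z hz hi
      rw [hc z hz z (D.self_mem z)]
      exact (hg z hz).2.1 hi
    · rw [← hP]
      exact Set.image_congr hty
  choose c hc hP using h1
  refine ⟨c, hc, fun h h' he => ?_⟩
  have h2 := image_kids_eq (p := fun _ => True) (fun _ _ _ _ => trivial) he
  rw [kids_true, hP, hP] at h2
  exact P.injective (Subtype.ext h2)

theorem Good.plentiful (hD : D.Admissible m) {x : V} (hx : D.Good m x) : D.Plentiful x := by
  induction hx with
  | intro x _ ih =>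
    intro b
    obtain ⟨c, hc, hinj⟩ := hD.exists_coloring (x := x) (fun z hz => by
      by_cases hm : m ≤ #(D.below z)
      · exact ih z ⟨hz, hm⟩
      · exact hD.plentiful_of_small (not_le.1 hm)) b True
    rw [← Cardinal.mk_set]
    refine Cardinal.mk_le_of_injective (f := fun h => ⟨D.ty x (c h), c h, (hc h).1, (hc h).2.1, rfl⟩)
      fun h h' he => hinj (congrArg Subtype.val he)

end Rooted
end AsymTree

/-! ### Vertices that are not good: counting types of auxiliary colourings -/

namespace AsymTree

theorem sum_mul_left {ι : Type v} (a : Cardinal.{u}) (f : ι → Cardinal.{u}) :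
    Cardinal.sum (fun i => a * f i) = Cardinal.lift.{v} a * Cardinal.sum f := by
  induction a using Cardinal.inductionOn with
  | mk A =>
    have h1 : Cardinal.sum f = #(Σ i, (f i).out) := by simp [Cardinal.mk_sigma]
    have h2 : Cardinal.sum (fun i => #A * f i) = #(Σ i, A × (f i).out) := by
      simp [Cardinal.mk_sigma]
    rw [h1, h2]
    have e : (Σ i, A × (f i).out) ≃ A × Σ i, (f i).out :=
      { toFun := fun p => (p.2.1, ⟨p.1, p.2.2⟩)
        invFun := fun p => ⟨p.2.1, p.1, p.2.2⟩
        left_inv := fun _ => rfl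
        right_inv := fun _ => rfl }
    have h3 := Cardinal.mk_congr e
    rw [h3, Cardinal.mk_prod]
    congr 1
    · exact congrFun Cardinal.lift_umax.{u, v} #A
    · exact Cardinal.lift_id' _

namespace Rooted

variable {V : Type u} {D : Rooted V} {m : Cardinal.{u}}

variable (D m) in
/-- The part of the branch at `y` that lies above the good children of `y`. -/
def twigs (y : V) : Set V := ⋃ z ∈ D.kids (D.Good m) y, D.below z

variable (D m) in
/-- The children of `y` that are not good. -/
def limbs (y : V) : Set V := D.kids (fun z => ¬ D.Good m z) y

variable (D m) in
/-- The vertices of the branch at `x` which are not good and have distance `n` to `x`. -/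
def layer (n : ℕ) (x : V) : Set V := {y | y ∈ D.below x ∧ ¬ D.Good m y ∧ D.lev y = D.lev x + n}

theorem layer_nonempty {x : V} (hx : ¬ D.Good m x) (n : ℕ) : (D.layer m n x).Nonempty := by
  induction n with
  | zero => exact ⟨x, D.self_mem _, hx, rfl⟩
  | succ n ih =>
    obtain ⟨y, hy, hgy, hl⟩ := ih
    obtain ⟨z, hz, hgz⟩ := exists_child_not_good hgy
    exact ⟨z, D.mem_trans (IsChild.mem D hz) hy, hgz, by rw [IsChild.lev D hz, hl]; rfl⟩

/-- Walk from `w` towards `x` until the first vertex that is not good. A branch is thus covered by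
its bad vertices together with their twigs. -/
theorem exists_mem_insert_twigs {x w : V} (hx : ¬ D.Good m x) (hw : w ∈ D.below x) :
    ∃ y ∈ D.below x, ¬ D.Good m y ∧ w ∈ insert y (D.twigs m y) := by
  have key : ∀ n : ℕ, ∀ w ∈ D.below x, D.lev w = n →
      ∃ y ∈ D.below x, ¬ D.Good m y ∧ w ∈ insert y (D.twigs m y) := by
    intro n
    induction n with
    | zero =>
      intro w hw hl
      have : w = x := by
        by_contra hne
        have := D.lev_lt hw hne
        omega
      exact ⟨w, hw, this ▸ hx, Set.mem_insert _ _⟩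
    | succ n ih =>
      intro w hw hl
      by_cases hg : D.Good m w
      · have hne : w ≠ x := by rintro rfl; exact hx hg
        have hp := D.par_mem hw hne
        have hc := D.isChild_par hw hne
        by_cases hgp : D.Good m (D.par w)
        · obtain ⟨y, hy, hyg, hin⟩ := ih _ hp (by rw [lev_par]; omega)
          refine ⟨y, hy, hyg, ?_⟩
          rcases hin with rfl | hin
          · exact absurd hgp hyg
          · obtain ⟨z, hz, hwz⟩ := Set.mem_iUnion₂.1 hin
            exact Or.inr (Set.mem_iUnion₂.2 ⟨z, hz, D.mem_trans (D.mem_par w) hwz⟩)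
        · exact ⟨_, hp, hgp, Or.inr (Set.mem_iUnion₂.2 ⟨w, ⟨hc, hg⟩, D.self_mem w⟩)⟩
      · exact ⟨w, hw, hg, Set.mem_insert _ _⟩
  exact key _ w hw rfl

/-- The weight `1 + κ y` stands for `y` and its twigs up to a factor `ℵ₀`: finitely many twigs may
be ignored. -/
theorem mk_below_le {κ : V → Cardinal.{u}}
    (hκ : ∀ y, ¬ D.Good m y → #(insert y (D.twigs m y) : Set V) ≤ ℵ₀ * (1 + κ y))
    {x : V} (hx : ¬ D.Good m x) :
    #(D.below x) ≤ ℵ₀ * Cardinal.sum fun n : ℕ =>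
      Cardinal.sum fun y : D.layer m n x => 1 + κ y := by
  have h1 : D.below x ⊆ ⋃ n : ℕ, ⋃ y : D.layer m n x, insert y.1 (D.twigs m y) := by
    intro w hw
    obtain ⟨y, hy, hyg, hin⟩ := exists_mem_insert_twigs hx hw
    have hl := D.lev_le hy
    exact Set.mem_iUnion.2 ⟨D.lev y - D.lev x, Set.mem_iUnion.2 ⟨⟨y, hy, hyg, by omega⟩, hin⟩⟩
  refine (Cardinal.mk_le_mk_of_subset h1).trans ?_
  have h2 := Cardinal.mk_iUnion_le_sum_mk_lift
    (f := fun n : ℕ => ⋃ y : D.layer m n x, insert y.1 (D.twigs m y))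
  rw [Cardinal.lift_uzero] at h2
  refine h2.trans ?_
  have h3 := fun f : ℕ → Cardinal.{u} => sum_mul_left ℵ₀ f
  simp only [Cardinal.lift_uzero] at h3
  rw [← h3]
  refine Cardinal.sum_le_sum _ _ fun n => ?_
  refine Cardinal.mk_iUnion_le_sum_mk.trans ?_
  have h4 := fun f : D.layer m n x → Cardinal.{u} => sum_mul_left ℵ₀ f
  simp only [Cardinal.lift_id] at h4
  rw [← h4]
  exact Cardinal.sum_le_sum _ _ fun y => hκ y y.2.2.1

/-- An isomorphism-invariant list of admissible colours. -/
structure Palette (D : Rooted V) (X : Type u) where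
  ok : V → X → Prop
  nonempty : ∀ w, ∃ a, ok w a
  inv : ∀ {e e' : V → V} {x y : V}, D.IsIso e e' x y → ∀ w ∈ D.below x, ∀ a,
    ok w a → ok (e w) a

namespace Palette

variable {X : Type u} (O : D.Palette X)

/-- The types of the colourings of the branch at `x` with admissible colours. -/
def types (x : V) : Set (D.BType X) := {q | ∃ c : V → X, (∀ w, O.ok w (c w)) ∧ D.ty x c = q}

theorem types_eq_of_rel {x y : V} (h : D.Rel x y) : O.types x = O.types y := by
  classical
  have key : ∀ x y : V, D.Rel x y → O.types x ⊆ O.types y := by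
    rintro x y ⟨e, e', he⟩ _ ⟨c, hc, rfl⟩
    choose d hd using O.nonempty
    refine ⟨fun w => if w ∈ D.below y then c (e' w) else d w, fun w => ?_, ?_⟩
    · by_cases hw : w ∈ D.below y
      · simp only [hw, if_true]
        have := O.inv he (e' w) (he.maps' w hw) _ (hc (e' w))
        rwa [he.inv' w hw] at this
      · simp only [hw, if_false]
        exact hd w
    · rw [← IsIso.ty_eq D he c]
      refine D.ty_congr fun w hw => ?_
      simp [hw]
  exact (key _ _ h).antisymm (key _ _ h.symm)

variable {O} in
theorem rel_of_mem_types {x y : V} {q} (h : q ∈ O.types x) (h' : q ∈ O.types y) : D.Rel x y := by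
  obtain ⟨c, _, rfl⟩ := h
  obtain ⟨c', _, h⟩ := h'
  exact rel_of_ty_eq h.symm

theorem types_nonempty (x : V) : (O.types x).Nonempty := by
  choose d hd using O.nonempty
  exact ⟨_, d, hd, rfl⟩

theorem exists_coloring {y : V} {a : X} (ha : O.ok y a) {f : V → D.BType X}
    (hf : ∀ z, D.IsChild z y → f z ∈ O.types z) :
    ∃ c : V → X, (∀ w, O.ok w (c w)) ∧ c y = a ∧ ∀ z, D.IsChild z y → D.ty z c = f z := by
  classical
  choose d hd using O.nonempty
  have : Nonempty X := ⟨a⟩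
  choose! g hg hgf using hf
  obtain ⟨c, hcy, hc⟩ := D.exists_glue y a g
  refine ⟨fun w => if w ∈ D.below y then c w else d w, fun w => ?_, by simp [D.self_mem, hcy], ?_⟩
  · by_cases hw : w ∈ D.below y
    · simp only [hw, if_true]
      by_cases hne : w = y
      · subst hne; rwa [hcy]
      · rw [hc _ (D.isChild_anc hw hne) w (D.anc_mem _ _)]
        exact hg _ (D.isChild_anc hw hne) w
    · simp only [hw, if_false]
      exact hd w
  · intro z hz
    rw [← hgf z hz]
    refine D.ty_congr fun w hw => ?_
    have hwy := D.mem_trans hw (IsChild.mem D hz)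
    simp only [hwy, if_true]
    exact hc z hz w hw

theorem mk_ok_le (y : V) : #{a // O.ok y a} ≤ #(O.types y) := by
  choose f hf using O.types_nonempty
  choose c hc hcy _ using fun a : {a // O.ok y a} => O.exists_coloring a.2 (f := f)
    (fun z _ => hf z)
  refine Cardinal.mk_le_of_injective (f := fun a => ⟨D.ty y (c a), c a, hc a, rfl⟩) ?_
  intro a b h
  have h1 := D.apex_color_eq (congrArg Subtype.val h)
  rw [hcy, hcy] at h1
  exact Subtype.ext h1

/-- Any small enough nonempty set of types can be realized on an isomorphism class of limbs. -/
theorem exists_image_inter {y : V} {a : X} (ha : O.ok y a) (z : D.limbs m y)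
    {N : Set (D.BType X)} (hN : N ⊆ O.types z) (hne : N.Nonempty)
    (hcard : #N ≤ #{z' // D.relSetoid (D.limbs m y) z z'}) :
    ∃ c : V → X, (∀ w, O.ok w (c w)) ∧ c y = a ∧
      ((fun z => D.ty z c) '' D.limbs m y) ∩ O.types z = N := by
  classical
  obtain ⟨g⟩ := hcard
  have : Nonempty N := hne.to_subtype
  let s : {z' // D.relSetoid (D.limbs m y) z z'} → N := Function.invFun g
  have hs : Function.Surjective s := Function.invFun_surjective g.injective
  choose f0 hf0 using O.types_nonempty
  let f : V → D.BType X := fun w =>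
    if h : ∃ hw : w ∈ D.limbs m y, D.relSetoid (D.limbs m y) z ⟨w, hw⟩
    then s ⟨⟨w, h.1⟩, h.2⟩ else f0 w
  have hf : ∀ w, f w ∈ O.types w := by
    intro w
    by_cases h : ∃ hw : w ∈ D.limbs m y, D.relSetoid (D.limbs m y) z ⟨w, hw⟩
    · simp only [f, h, dite_true]
      obtain ⟨hw, hr⟩ := h
      rw [← O.types_eq_of_rel hr]
      exact hN (Subtype.prop _)
    · simp only [f, h, dite_false]
      exact hf0 w
  obtain ⟨c, hc, hcy, hcz⟩ := O.exists_coloring ha (f := f) (fun w _ => hf w)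
  refine ⟨c, hc, hcy, ?_⟩
  ext q
  constructor
  · rintro ⟨⟨w, hw, rfl⟩, hq⟩
    have hq : D.ty w c ∈ O.types z := hq
    have h1 : D.Rel z w := rel_of_mem_types hq ⟨c, hc, rfl⟩
    have h2 : ∃ hw : w ∈ D.limbs m y, D.relSetoid (D.limbs m y) z ⟨w, hw⟩ := ⟨hw, h1⟩
    change D.ty w c ∈ N
    rw [hcz w hw.1]
    simp only [f, h2, dite_true]
    exact Subtype.prop _
  · intro hq
    refine ⟨?_, hN hq⟩
    obtain ⟨w, hw⟩ := hs ⟨q, hq⟩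
    refine ⟨w.1, w.1.2, ?_⟩
    have h2 : ∃ hw : w.1.1 ∈ D.limbs m y, D.relSetoid (D.limbs m y) z ⟨w.1.1, hw⟩ :=
      ⟨w.1.2, w.2⟩
    change D.ty w.1.1 c = q
    rw [hcz _ w.1.2.1]
    simp only [f, h2, dite_true]
    exact congrArg Subtype.val hw

theorem not_good_rel {m : Cardinal.{u}} (z z' : V) (h : D.Rel z z') (hz : ¬ D.Good m z) :
    ¬ D.Good m z' :=
  fun h' => hz (h'.of_rel h.symm)

theorem image_limbs_eq {y y' : V} {c c' : V → X} (h : D.ty y c = D.ty y' c') :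
    (fun z => D.ty z c) '' D.limbs m y = (fun z => D.ty z c') '' D.limbs m y' :=
  image_kids_eq not_good_rel h

/-- Give all limbs isomorphic to `z` the same type. This type and the colour of `y` can be read off
from the type of `y`. -/
theorem mk_ok_mul_le {y z : V} (hz : z ∈ D.limbs m y) :
    #{a // O.ok y a} * #(O.types z) ≤ #(O.types y) := by
  have h1 : ∀ p : {a // O.ok y a} × O.types z, ∃ c : V → X, (∀ w, O.ok w (c w)) ∧ c y = p.1 ∧
      ((fun z => D.ty z c) '' D.limbs m y) ∩ O.types z = {p.2.1} := by
    intro p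
    refine O.exists_image_inter p.1.2 ⟨z, hz⟩ (by simp) (by simp) ?_
    rw [Cardinal.mk_singleton, Cardinal.one_le_iff_ne_zero, Cardinal.mk_ne_zero_iff]
    exact ⟨⟨⟨z, hz⟩, Rel.refl D z⟩⟩
  choose c hc hcy hcz using h1
  rw [Cardinal.mul_def]
  refine Cardinal.mk_le_of_injective (f := fun p => ⟨D.ty y (c p), c p, hc p, rfl⟩) ?_
  intro p p' h
  have h : D.ty y (c p) = D.ty y (c p') := congrArg Subtype.val h
  have h2 := D.apex_color_eq h
  rw [hcy, hcy] at h2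
  have h3 := hcz p
  rw [image_limbs_eq h, hcz p'] at h3
  exact Prod.ext (Subtype.ext h2) (Subtype.ext (Set.singleton_injective h3).symm)

theorem mk_types_le_of_limb {y z : V} (hz : z ∈ D.limbs m y) : #(O.types z) ≤ #(O.types y) := by
  refine le_trans ?_ (O.mk_ok_mul_le hz)
  refine le_mul_of_one_le_left zero_le ?_
  rw [Cardinal.one_le_iff_ne_zero, Cardinal.mk_ne_zero_iff]
  obtain ⟨a, ha⟩ := O.nonempty y
  exact ⟨⟨a, ha⟩⟩

theorem mk_types_le {x w : V} (hw : w ∈ D.below x) (hg : ¬ D.Good m w) :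
    #(O.types w) ≤ #(O.types x) := by
  have key : ∀ n : ℕ, ∀ w ∈ D.below x, ¬ D.Good m w → D.lev w = n →
      #(O.types w) ≤ #(O.types x) := by
    intro n
    induction n with
    | zero =>
      intro w hw _ hl
      by_cases hne : w = x
      · rw [hne]
      · have := D.lev_lt hw hne
        omega
    | succ n ih =>
      intro w hw hg hl
      by_cases hne : w = x
      · rw [hne]
      · exact (O.mk_types_le_of_limb ⟨D.isChild_par hw hne, hg⟩).trans
          (ih _ (D.par_mem hw hne) (not_good_of_mem hg (D.mem_par w)) (by rw [lev_par]; omega))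
  exact key _ w hw hg rfl

/-- If the class had more members than there are types at `z`, every nonempty set of these types
could be realized on it. Then `y` would have as many types as there are such sets, contradicting
Cantor's theorem and `he`. -/
theorem mk_class_le {y : V} (z : D.limbs m y) (hν : ℵ₀ ≤ #(O.types z))
    (he : #(O.types y) = #(O.types z)) :
    #{z' // D.relSetoid (D.limbs m y) z z'} ≤ #(O.types z) := by
  by_contra! hlt
  obtain ⟨a, ha⟩ := O.nonempty y
  obtain ⟨t, ht⟩ := O.types_nonempty z
  have h1 : ∀ N : {N : Set (O.types z) // N.Nonempty}, ∃ c : V → X, (∀ w, O.ok w (c w)) ∧ c y = a ∧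
      ((fun z => D.ty z c) '' D.limbs m y) ∩ O.types z = Subtype.val '' N.1 := by
    intro N
    refine O.exists_image_inter ha z (by simp) (N.2.image _) ?_
    exact Cardinal.mk_image_le.trans ((Cardinal.mk_set_le _).trans hlt.le)
  choose c hc _ hcz using h1
  have h2 : #{N : Set (O.types z) // N.Nonempty} ≤ #(O.types y) := by
    refine Cardinal.mk_le_of_injective (f := fun p => ⟨D.ty y (c p), c p, hc p, rfl⟩) ?_
    intro p p' h
    have h : D.ty y (c p) = D.ty y (c p') := congrArg Subtype.val h
    have h3 := hcz p
    rw [image_limbs_eq h, hcz p'] at h3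
    exact Subtype.ext (Set.image_injective.2 Subtype.val_injective h3).symm
  have h3 : 2 ^ #(O.types z) ≤ #{N : Set (O.types z) // N.Nonempty} + 1 := by
    rw [← Cardinal.mk_set, ← Cardinal.mk_option]
    refine Cardinal.mk_le_of_surjective (f := fun o => o.elim ∅ Subtype.val) ?_
    intro N
    rcases N.eq_empty_or_nonempty with rfl | hN
    · exact ⟨none, rfl⟩
    · exact ⟨some ⟨N, hN⟩, rfl⟩
  rw [he] at h2
  have h4 := h3.trans (add_le_add_left h2 1)
  rw [Cardinal.add_one_eq hν] at h4
  exact absurd h4 (Cardinal.cantor _).not_ge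

/-- With $\nu$ the common number of types, each class has at most $\nu$ limbs. As $\nu \cdot \nu =
\nu$, the limbs get disjoint supplies of $\nu$ types each, and independent choices from them give
different types of `y`. -/
theorem power_mk_limbs_le {y : V} (hν : ℵ₀ ≤ #(O.types y))
    (he : ∀ z ∈ D.limbs m y, #(O.types z) = #(O.types y)) :
    #(O.types y) ^ #(D.limbs m y) ≤ #(O.types y) := by
  classical
  have : Nonempty (D.BType X) := (O.types_nonempty y).to_subtype.map Subtype.val
  obtain ⟨ι, h1, h2⟩ := exists_disjoint_selection (D.relSetoid (D.limbs m y)) (fun z => O.types z)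
    (fun _ => (Set.univ : Set (O.types y))) (fun z z' h => O.types_eq_of_rel h)
    (fun z z' q h h' => rel_of_mem_types h h') (fun z => by
      rw [Cardinal.mk_univ, Cardinal.sum_const']
      have h3 := O.mk_class_le z (by rwa [he z z.2]) (he z z.2).symm
      rw [he z z.2] at h3 ⊢
      exact (mul_le_mul_left h3 _).trans (Cardinal.mul_eq_self hν).le)
  obtain ⟨a, ha⟩ := O.nonempty y
  choose f0 hf0 using O.types_nonempty
  let F : (D.limbs m y → O.types y) → V → D.BType X := fun h z =>
    if hz : z ∈ D.limbs m y then ι ⟨z, hz⟩ (h ⟨z, hz⟩) else f0 z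
  have hF : ∀ h, ∀ z (hz : z ∈ D.limbs m y), F h z = ι ⟨z, hz⟩ (h ⟨z, hz⟩) := by
    intro h z hz
    simp only [F, hz, dite_true]
  have hFt : ∀ h z, F h z ∈ O.types z := by
    intro h z
    by_cases hz : z ∈ D.limbs m y
    · rw [hF h z hz]
      exact h1 ⟨z, hz⟩ _ (Set.mem_univ _)
    · simp only [F, hz, dite_false]
      exact hf0 z
  choose c hc _ hcz using fun h => O.exists_coloring ha (f := F h) (fun z _ => hFt h z)
  rw [Cardinal.power_def]
  refine Cardinal.mk_le_of_injective (f := fun h => ⟨D.ty y (c h), c h, hc h, rfl⟩) ?_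
  intro h h' he
  have he := image_limbs_eq (m := m) (congrArg Subtype.val he)
  funext z
  have h3 : D.ty z (c h) ∈ (fun z => D.ty z (c h')) '' D.limbs m y :=
    he ▸ Set.mem_image_of_mem _ z.2
  obtain ⟨z', hz', h4⟩ := h3
  have h4 : D.ty z' (c h') = D.ty z (c h) := h4
  rw [hcz _ _ z.2.1, hcz _ _ hz'.1, hF _ _ z.2, hF _ _ hz'] at h4
  obtain ⟨h5, h6⟩ := h2 _ _ _ (Set.mem_univ _) _ (Set.mem_univ _) h4
  rw [h5] at h6
  exact h6.symm

theorem layer_succ_subset (n : ℕ) (x : V) :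
    D.layer m (n + 1) x ⊆ ⋃ y : D.layer m n x, D.limbs m y := by
  rintro w ⟨hw, hg, hl⟩
  have hne : w ≠ x := by rintro rfl; omega
  refine Set.mem_iUnion.2 ⟨⟨D.par w, D.par_mem hw hne, not_good_of_mem hg (D.mem_par w), ?_⟩,
    D.isChild_par hw hne, hg⟩
  rw [lev_par]; omega

/-- The next layer is the union of the limbs at the present one, so the bound for limbs iterates:
$\prod_y \nu^{k_y} \le \prod_y \nu \le \nu$. -/
theorem power_mk_layer_le {x : V} {ν : Cardinal.{u}} (hν : ℵ₀ ≤ ν)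
    (he : ∀ w ∈ D.below x, ¬ D.Good m w → #(O.types w) = ν) (n : ℕ) :
    ν ^ #(D.layer m n x) ≤ ν := by
  have h0 : ν ≠ 0 := (Cardinal.aleph0_pos.trans_le hν).ne'
  induction n with
  | zero =>
    have h1 : D.layer m 0 x ⊆ {x} := by
      rintro w ⟨hw, -, hl⟩
      by_contra hne
      have := D.lev_lt hw hne
      omega
    have h2 : #(D.layer m 0 x) ≤ 1 := by
      rw [← Cardinal.mk_singleton x]
      exact Cardinal.mk_le_mk_of_subset h1
    exact (Cardinal.power_le_power_left h0 h2).trans (Cardinal.power_one ν).le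
  | succ n ih =>
    refine (Cardinal.power_le_power_left h0 ((Cardinal.mk_le_mk_of_subset
      (layer_succ_subset n x)).trans Cardinal.mk_iUnion_le_sum_mk)).trans ?_
    rw [Cardinal.power_sum]
    refine (Cardinal.prod_le_prod _ (fun _ => ν) fun y => ?_).trans ?_
    · have h1 := he y y.2.1 y.2.2.1
      rw [← h1]
      refine O.power_mk_limbs_le (by rwa [h1]) fun z hz => ?_
      rw [h1]
      exact he z (D.mem_trans (IsChild.mem D hz.1) y.2.1) hz.2
    · rwa [Cardinal.prod_const']

/-- The number of types below some vertex is at least exponential in the weight of each layer. -/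
theorem exists_forall_layer {κ : V → Cardinal.{u}}
    (hκ : ∀ y, ¬ D.Good m y → 2 ^ κ y ≤ #{a // O.ok y a})
    (h2 : ∀ x, ¬ D.Good m x → ∃ y ∈ D.below x, ¬ D.Good m y ∧ ∃ a b, O.ok y a ∧ O.ok y b ∧ a ≠ b)
    {x : V} (hx : ¬ D.Good m x) :
    ℵ₀ ≤ #(O.types x) ∧ ∃ x₀ ∈ D.below x, ¬ D.Good m x₀ ∧ ∀ n,
      2 ^ (Cardinal.sum fun y : D.layer m n x₀ => 1 + κ y) ≤ #(O.types x) := by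
  -- The number of types cannot increase on passing to a bad descendant. At a minimum it is
  -- therefore constant on all bad vertices above.
  obtain ⟨x₀, ⟨hx₀, hg₀⟩, hmin⟩ := exists_minimalFor_of_wellFoundedLT
    (fun w => w ∈ D.below x ∧ ¬ D.Good m w) (fun w => #(O.types w)) ⟨x, D.self_mem x, hx⟩
  have he : ∀ w ∈ D.below x₀, ¬ D.Good m w → #(O.types w) = #(O.types x₀) := by
    intro w hw hg
    have h3 := O.mk_types_le hw hg
    exact h3.antisymm (hmin ⟨D.mem_trans hw hx₀, hg⟩ h3)
  have hle := O.mk_types_le hx₀ hg₀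
  have hν : ℵ₀ ≤ #(O.types x₀) := by
    obtain ⟨y, hy, hgy, a, b, ha, hb, hab⟩ := h2 x₀ hg₀
    obtain ⟨z, hzy, hgz⟩ := exists_child_not_good hgy
    have h4 := O.mk_ok_mul_le (m := m) (y := y) (z := z) ⟨hzy, hgz⟩
    -- A vertex with two admissible colours yields $2\nu \le \nu$, which is impossible for finite
    -- $\nu > 0$.
    rw [he y hy hgy, he z (D.mem_trans (IsChild.mem D hzy) hy) hgz] at h4
    by_contra! hlt
    obtain ⟨k, hk⟩ := Cardinal.lt_aleph0.1 hlt
    have h5 : 2 ≤ #{a // O.ok y a} := by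
      rw [Cardinal.two_le_iff]
      exact ⟨⟨a, ha⟩, ⟨b, hb⟩, fun h => hab (congrArg Subtype.val h)⟩
    have h6 := (mul_le_mul_left h5 _).trans h4
    have h7 : #(O.types x₀) ≠ 0 := by
      rw [Cardinal.mk_ne_zero_iff]
      exact (O.types_nonempty x₀).to_subtype
    rw [hk] at h6 h7
    norm_cast at h6 h7
    omega
  refine ⟨hν.trans hle, x₀, hx₀, hg₀, fun n => le_trans ?_ hle⟩
  have h0 : #(O.types x₀) ≠ 0 := (Cardinal.aleph0_pos.trans_le hν).ne'
  rw [Cardinal.power_sum]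
  refine (Cardinal.prod_le_prod _ (fun _ => #(O.types x₀)) fun y => ?_).trans ?_
  · rw [Cardinal.power_add, Cardinal.power_one]
    have h3 := (hκ y y.2.2.1).trans (O.mk_ok_le y)
    rw [he y y.2.1 y.2.2.1] at h3
    refine (mul_le_mul' ((Cardinal.ofNat_lt_aleph0 (n := 2)).le.trans hν) h3).trans ?_
    exact (Cardinal.mul_eq_self hν).le
  · rw [Cardinal.prod_const']
    exact O.power_mk_layer_le hν he n

end Palette

/-- Countably many independent colourings of a branch without good apex have at least `2 ^ m`
combinations of types. -/
theorem le_mk_pi_types {X : Type u} (hm : ℵ₀ ≤ m) (O : ℕ → D.Palette X) {κ : V → Cardinal.{u}}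
    (hκ : ∀ y, ¬ D.Good m y → #(insert y (D.twigs m y) : Set V) ≤ ℵ₀ * (1 + κ y))
    (hok : ∀ k y, ¬ D.Good m y → 2 ^ κ y ≤ #{a // (O k).ok y a})
    (h2 : ∀ k x, ¬ D.Good m x →
      ∃ y ∈ D.below x, ¬ D.Good m y ∧ ∃ a b, (O k).ok y a ∧ (O k).ok y b ∧ a ≠ b)
    {x : V} (hx : ¬ D.Good m x) :
    2 ^ m ≤ #{v : ℕ → D.BType X // ∀ k, v k ∈ (O k).types x} := by
  classical
  let W : ℕ → V → Cardinal.{u} := fun n x => Cardinal.sum fun y : D.layer m n x => 1 + κ y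
  have hW : ∀ x, ¬ D.Good m x → m ≤ ℵ₀ * Cardinal.sum fun n : ℕ => W n x := fun x hx =>
    (big_of_not_good hx).trans (mk_below_le hκ hx)
  have hpi : #{v : ℕ → D.BType X // ∀ k, v k ∈ (O k).types x} =
      Cardinal.prod fun k => #((O k).types x) := by
    rw [← Cardinal.mk_pi]
    exact Cardinal.mk_congr
      { toFun := fun v k => ⟨v.1 k, v.2 k⟩
        invFun := fun v => ⟨fun k => (v k).1, fun k => (v k).2⟩
        left_inv := fun _ => rfl
        right_inv := fun _ => rfl }
  rw [hpi]
  have hex := fun k => (O k).exists_forall_layer (hok k) (h2 k) hx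
  -- If some infinite `l < m` failed, every layer of `x₁` would have weight at most `l`, and the
  -- branch at `x₁` would have size at most $\aleph_0 \cdot \aleph_0 \cdot l = l < m$.
  have hweak : ∀ k, ∀ l < m, 2 ^ l ≤ #((O k).types x) := by
    intro k l hl
    obtain ⟨hinf, x₁, hx₁, hg₁, hle⟩ := hex k
    rcases lt_or_ge l ℵ₀ with hfin | hinf'
    · obtain ⟨i, rfl⟩ := Cardinal.lt_aleph0.1 hfin
      exact (Cardinal.power_lt_aleph0 (Cardinal.ofNat_lt_aleph0 (n := 2)) hfin).le.trans hinf
    · by_contra! hc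
      have hlt : ∀ n, W n x₁ ≤ l := by
        intro n
        by_contra! hln
        exact absurd ((Cardinal.power_le_power_left two_ne_zero hln.le).trans (hle n)) hc.not_ge
      refine absurd (hW x₁ hg₁) (not_le.2 (lt_of_le_of_lt ?_ hl))
      have h3 := (Cardinal.sum_le_sum _ _ hlt)
      rw [Cardinal.sum_const, Cardinal.mk_nat, Cardinal.lift_aleph0, Cardinal.lift_uzero] at h3
      refine (mul_le_mul_right h3 ℵ₀).trans ?_
      rw [Cardinal.aleph0_mul_eq hinf', Cardinal.aleph0_mul_eq hinf']
  obtain ⟨-, x₀, -, hg₀, hle⟩ := hex 0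
  -- A single layer of weight at least `m` makes one auxiliary colouring sufficient. Otherwise
  -- colouring `k` accounts for layer `k` of `x₀`, whose weight is below `m`, and the product over
  -- `k` collects the total weight.
  by_cases hbig : ∃ n, m ≤ W n x₀
  · obtain ⟨n, hn⟩ := hbig
    refine ((Cardinal.power_le_power_left two_ne_zero hn).trans (hle n)).trans ?_
    rw [← Cardinal.mk_pi]
    choose t ht using fun k => (O k).types_nonempty x
    refine Cardinal.mk_le_of_injective
      (f := fun q => Function.update (fun k => (⟨t k, ht k⟩ : (O k).types x)) 0 q) ?_
    intro q q' h
    have h4 := congrFun h 0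
    simpa using h4
  · push Not at hbig
    have h3 : Cardinal.prod (fun k : ℕ => (2 : Cardinal.{u}) ^ W k x₀) ≤
        Cardinal.prod fun k => #((O k).types x) :=
      Cardinal.prod_le_prod _ _ fun k => hweak k _ (hbig k)
    refine le_trans ?_ h3
    rw [← Cardinal.power_sum]
    refine Cardinal.power_le_power_left two_ne_zero ?_
    have h4 := hm.trans (hW x₀ hg₀)
    have h5 : ℵ₀ ≤ Cardinal.sum fun n : ℕ => W n x₀ := by
      have h6 : ∀ n, 1 ≤ W n x₀ := by
        intro n
        have h7 := layer_nonempty hg₀ n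
        obtain ⟨y, hy⟩ := h7
        exact (self_le_add_right 1 (κ y)).trans
          (Cardinal.le_sum (fun y : D.layer m n x₀ => 1 + κ y) ⟨y, hy⟩)
      have h7 := Cardinal.sum_le_sum (fun _ : ℕ => (1 : Cardinal.{u})) _ h6
      rwa [Cardinal.sum_const, Cardinal.mk_nat, Cardinal.lift_aleph0, Cardinal.lift_one,
        mul_one] at h7
    have h8 := hW x₀ hg₀
    rwa [Cardinal.aleph0_mul_eq h5] at h8

end Rooted
end AsymTree

/-! ### Encoding countably many auxiliary colourings in one vertex set -/

namespace AsymTree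
namespace Rooted

variable {V : Type u} {D : Rooted V} {m : Cardinal.{u}}

theorem Rel.mk_below {x y : V} (h : D.Rel x y) : #(D.below x) = #(D.below y) := by
  obtain ⟨e, e', h⟩ := h
  exact h.mk_below

theorem IsIso.rel {e e' : V → V} {x y w : V} (h : D.IsIso e e' x y) (hw : w ∈ D.below x) :
    D.Rel w (e w) := ⟨e, e', h.restrict hw⟩

theorem IsIso.mem_kids_good {e e' : V → V} {x y z : V} (h : D.IsIso e e' x y)
    (hz : z ∈ D.kids (D.Good m) x) : e z ∈ D.kids (D.Good m) y := by
  have h1 := h.isChild (D.self_mem x) hz.1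
  rw [h.apex] at h1
  exact ⟨h1, hz.2.of_rel (h.rel (IsChild.mem D hz.1))⟩

theorem mk_twigs_eq {x y : V} (h : D.Rel x y) : #(D.twigs m x) = #(D.twigs m y) := by
  have key : ∀ x y : V, D.Rel x y → #(D.twigs m x) ≤ #(D.twigs m y) := by
    rintro x y ⟨e, e', h⟩
    have hsub : ∀ w ∈ D.twigs m x, w ∈ D.below x ∧ e w ∈ D.twigs m y := by
      intro w hw
      obtain ⟨z, hz, hwz⟩ := Set.mem_iUnion₂.1 hw
      have hzx := IsChild.mem D hz.1
      exact ⟨D.mem_trans hwz hzx,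
        Set.mem_iUnion₂.2 ⟨e z, h.mem_kids_good hz, h.maps_below hzx hwz⟩⟩
    refine Cardinal.mk_le_of_injective (f := fun w => ⟨e w, (hsub w w.2).2⟩) ?_
    intro w w' he
    have he : e w = e w' := congrArg Subtype.val he
    apply Subtype.ext
    rw [← h.inv w (hsub w w.2).1, he, h.inv w' (hsub w' w'.2).1]
  exact (key _ _ h).antisymm (key _ _ h.symm)

theorem patterns_eq_of_rel {x y : V} (h : D.Rel x y) (b : Prop) :
    D.patterns (D.kids (D.Good m) x) b = D.patterns (D.kids (D.Good m) y) b := by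
  have key : ∀ x y : V, D.Rel x y →
      D.patterns (D.kids (D.Good m) x) b ⊆ D.patterns (D.kids (D.Good m) y) b := by
    rintro x y ⟨e, e', h⟩ _ ⟨f, hinj, hf, rfl⟩
    have hmem : ∀ z ∈ D.kids (D.Good m) y, e' z ∈ D.kids (D.Good m) x := fun z hz =>
      h.symm.mem_kids_good hz
    refine ⟨f ∘ e', ?_, ?_, ?_⟩
    · intro z hz z' hz' he
      have h1 := hinj (hmem z hz) (hmem z' hz') he
      rw [← h.inv' z (IsChild.mem D hz.1), h1, h.inv' z' (IsChild.mem D hz'.1)]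
    · intro z hz
      rw [fam_eq_of_rel (h.symm.rel (IsChild.mem D hz.1))]
      exact hf _ (hmem z hz)
    · ext q
      constructor
      · rintro ⟨z, hz, rfl⟩
        exact ⟨e' z, hmem z hz, rfl⟩
      · rintro ⟨z, hz, rfl⟩
        exact ⟨e z, h.mem_kids_good hz, by simp [h.inv z (IsChild.mem D hz.1)]⟩
  exact (key _ _ h).antisymm (key _ _ h.symm)

open Classical in
/-- A set of vertices of the given cardinality, if there is one. -/
noncomputable def canonicalSet (V : Type u) (κ : Cardinal.{u}) : Set V :=
  if h : ∃ A : Set V, #A = κ then h.choose else ∅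

theorem mk_canonicalSet (A : Set V) : #(canonicalSet V #A) = #A := by
  have h : ∃ B : Set V, #B = #A := ⟨A, rfl⟩
  simp only [canonicalSet, h, dite_true]
  exact h.choose_spec

variable (D m) in
open Classical in
/-- A set of the size of the twigs at `y` if there are infinitely many of them, which depends only
on the isomorphism type. -/
noncomputable def stock (y : V) : Set V :=
  if ℵ₀ ≤ #(D.twigs m y) then canonicalSet V #(D.twigs m y) else ∅

theorem stock_eq_of_rel {x y : V} (h : D.Rel x y) : D.stock m x = D.stock m y := by
  rw [stock, stock, mk_twigs_eq h]

theorem mk_insert_twigs_le (y : V) :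
    #(insert y (D.twigs m y) : Set V) ≤ ℵ₀ * (1 + #(D.stock m y)) := by
  refine Cardinal.mk_insert_le.trans ?_
  by_cases h : ℵ₀ ≤ #(D.twigs m y)
  · simp only [stock, h, if_true, mk_canonicalSet]
    rw [add_comm]
    exact le_mul_of_one_le_left zero_le Cardinal.one_lt_aleph0.le
  · refine (Cardinal.add_lt_aleph0 (not_le.1 h) Cardinal.one_lt_aleph0).le.trans ?_
    exact le_mul_of_one_le_right zero_le (self_le_add_right 1 _)

/-- If $\tau$, the number of twig vertices, is infinite, sequences of subsets number only
$2^{\tau\aleph_0} = 2^{\tau}$, so the patterns on the good children suffice to encode one subset for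
every auxiliary colouring. -/
theorem mk_pi_stock_le (hD : D.Admissible m) (y : V) (b : Prop) :
    #{c : ℕ → Set V // ∀ j, c j ⊆ D.stock m y} ≤ #(D.patterns (D.kids (D.Good m) y) b) := by
  have h1 : #{c : ℕ → Set V // ∀ j, c j ⊆ D.stock m y} ≤ #(ℕ → Set (D.stock m y)) := by
    refine Cardinal.mk_le_of_injective (f := fun c j => Subtype.val ⁻¹' c.1 j) ?_
    intro c c' h
    apply Subtype.ext
    funext j
    have h2 : (Subtype.val ⁻¹' c.1 j : Set (D.stock m y)) = Subtype.val ⁻¹' c'.1 j := congrFun h j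
    rw [Subtype.preimage_val_eq_preimage_val_iff] at h2
    rwa [Set.inter_eq_right.2 (c.2 j), Set.inter_eq_right.2 (c'.2 j)] at h2
  have h3 := hD.le_mk_patterns (y := y) (Z := D.kids (D.Good m) y) (fun z hz => hz.1)
    (fun z hz => Good.plentiful hD hz.2) b
  refine h1.trans (le_trans ?_ h3)
  change _ ≤ 2 ^ #(D.twigs m y)
  rw [Cardinal.mk_pi, Cardinal.prod_const, Cardinal.mk_set, Cardinal.lift_uzero, Cardinal.mk_nat,
    Cardinal.lift_aleph0, ← Cardinal.power_mul]
  refine Cardinal.power_le_power_left two_ne_zero ?_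
  by_cases h : ℵ₀ ≤ #(D.twigs m y)
  · simp only [stock, h, if_true, mk_canonicalSet]
    rw [Cardinal.mul_aleph0_eq h]
  · simp [stock, h]

open Classical in
/-- A map from `P` onto the sequences of subsets of `A`, if there is one. -/
noncomputable def decode {Q : Type u} (P : Set Q) (A : Set V) : Q → ℕ → Set V :=
  if h : ∃ d : Q → ℕ → Set V, ∀ c : ℕ → Set V, (∀ j, c j ⊆ A) → ∃ q ∈ P, d q = c
  then h.choose else fun _ _ => ∅

theorem decode_spec {Q : Type u} {P : Set Q} {A : Set V}
    (h : #{c : ℕ → Set V // ∀ j, c j ⊆ A} ≤ #P) {c : ℕ → Set V} (hc : ∀ j, c j ⊆ A) :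
    ∃ q ∈ P, decode P A q = c := by
  classical
  have hex : ∃ d : Q → ℕ → Set V, ∀ c : ℕ → Set V, (∀ j, c j ⊆ A) → ∃ q ∈ P, d q = c := by
    obtain ⟨g⟩ := h
    have : Nonempty {c : ℕ → Set V // ∀ j, c j ⊆ A} := ⟨⟨c, hc⟩⟩
    refine ⟨fun q => if hq : q ∈ P then (Function.invFun g ⟨q, hq⟩).1 else fun _ => ∅,
      fun c hc => ⟨g ⟨c, hc⟩, Subtype.prop _, ?_⟩⟩
    simp [Function.leftInverse_invFun g.injective _]
  simp only [decode, hex, dite_true]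
  exact hex.choose_spec c hc

variable (D m) in
open Classical in
/-- The `j`-th auxiliary colouring which is defined by the set `S` of vertices. -/
noncomputable def aux (ind : ℕ → ℕ) (S : V → Prop) (j : ℕ) (y : V) : Prop × Set V :=
  if D.Good m y then (False, ∅) else
    (ind (D.lev y) = j ∧ S y,
      decode (D.patterns (D.kids (D.Good m) y) (¬ S (D.par y))) (D.stock m y)
        ((fun z => D.ty z S) '' D.kids (D.Good m) y) j)

/-- The ingredients of `aux` are invariant: `stock` depends only on a cardinal, `decode` only on its
two sets, and an unordered set of types is decoded. Hence an isomorphism respecting the sets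
respects all auxiliary colourings. -/
theorem aux_map (ind : ℕ → ℕ) {e e' : V → V} (h : D.IsIso e e' D.root D.root) {S S' : V → Prop}
    (hS : ∀ y, S' (e y) = S y) (j : ℕ) (y : V) :
    D.aux m ind S' j (e y) = D.aux m ind S j y := by
  have hy := D.mem_root y
  have hr := h.rel hy
  have hpar : D.par (e y) = e (D.par y) := by
    by_cases hne : y = D.root
    · subst hne
      rw [h.apex, D.par_root, h.apex]
    · exact h.par y hy hne
  have hg : D.Good m (e y) ↔ D.Good m y := ⟨fun h => h.of_rel hr.symm, fun h => h.of_rel hr⟩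
  have hty : D.ty y S = D.ty (e y) S' := D.ty_eq_iff.2 ⟨e, e', h.restrict hy, fun w _ => hS w⟩
  have him := image_kids_eq (p := D.Good m) (fun _ _ hr h => h.of_rel hr) hty
  by_cases hgy : D.Good m y
  · simp only [aux, hg.2 hgy, hgy, if_true]
  · simp only [aux, mt hg.1 hgy, hgy, if_false, h.lev y hy, hS, hpar, ← him, stock_eq_of_rel hr,
      patterns_eq_of_rel hr]

variable (D m) in
/-- The admissible colours of the `j`-th auxiliary colouring. -/
def palette (ind : ℕ → ℕ) (j : ℕ) : D.Palette (Prop × Set V) where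
  ok y a := (D.Good m y → a = (False, ∅)) ∧
    (¬ D.Good m y → (a.1 → ind (D.lev y) = j) ∧ a.2 ⊆ D.stock m y)
  nonempty w := ⟨(False, ∅), by simp⟩
  inv := by
    intro e e' x y h w hw a ha
    have hr := h.rel hw
    rw [h.lev w hw, ← stock_eq_of_rel hr]
    exact ⟨fun hg => ha.1 (hg.of_rel hr.symm), fun hg => ha.2 fun hg' => hg (hg'.of_rel hr)⟩

/-- Ancestors of `w` are linearly ordered and goodness passes to descendants, so good vertices turn
into bad ones only once on the way to the root. -/
theorem eq_of_good_tops {w z z' : V} (hw : w ∈ D.below z) (hw' : w ∈ D.below z')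
    (hz : D.Good m z) (hz' : D.Good m z') (hp : ¬ D.Good m (D.par z))
    (hp' : ¬ D.Good m (D.par z')) : z = z' := by
  have key : ∀ z z' : V, w ∈ D.below z → w ∈ D.below z' → D.Good m z → ¬ D.Good m (D.par z') →
      D.lev z ≤ D.lev z' → z = z' := by
    intro z z' hw hw' hz hp' hl
    have h1 : z' ∈ D.below z := by
      rw [mem_below_iff]
      refine ⟨hl, ?_⟩
      rw [← D.anc_of_mem hw', D.anc_anc hl (D.lev_le hw'), D.anc_of_mem hw]
    by_contra hne
    exact hp' (hz.of_mem (D.par_mem h1 (Ne.symm hne)))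
  rcases le_total (D.lev z) (D.lev z') with hl | hl
  · exact key z z' hw hw' hz hp' hl
  · exact (key z' z hw' hw hz' hp hl).symm

/-- All admissible auxiliary colourings can be prescribed simultaneously. -/
theorem Admissible.exists_aux_eq (hD : D.Admissible m) (hroot : ¬ D.Good m D.root) (ind : ℕ → ℕ)
    {c : ℕ → V → Prop × Set V} (hc : ∀ j w, (D.palette m ind j).ok w (c j w)) :
    ∃ S : V → Prop, (∀ j y, D.aux m ind S j y = c j y) ∧
      (∀ y, ¬ D.Good m y → (S y ↔ (c (ind (D.lev y)) y).1)) ∧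
      ∀ y, ¬ D.Good m y → Set.InjOn (fun z => D.ty z S) (D.kids (D.Good m) y) ∧
        ∀ z ∈ D.kids (D.Good m) y, D.Rigid z S ∧
          (ℵ₀ ≤ #(D.below z) → (S z ↔ ¬ S (D.par y))) := by
  classical
  -- Level `n` belongs to colouring `ind n` alone, so the bits on bad vertices never conflict.
  let bit : V → Prop := fun y => (c (ind (D.lev y)) y).1
  have h1 : ∀ y, ¬ D.Good m y → ∃ g : V → V → Prop, ∃ f : V → D.BType Prop,
      Set.InjOn f (D.kids (D.Good m) y) ∧
      decode (D.patterns (D.kids (D.Good m) y) (¬ bit (D.par y))) (D.stock m y)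
        (f '' D.kids (D.Good m) y) = (fun j => (c j y).2) ∧
      ∀ z ∈ D.kids (D.Good m) y, D.Rigid z (g z) ∧
        (ℵ₀ ≤ #(D.below z) → (g z z ↔ ¬ bit (D.par y))) ∧ D.ty z (g z) = f z := by
    intro y hy
    obtain ⟨P, ⟨f, hinj, hf, rfl⟩, hP⟩ := decode_spec (mk_pi_stock_le hD y (¬ bit (D.par y)))
      (c := fun j => (c j y).2) (fun j => ((hc j y).2 hy).2)
    obtain ⟨g, hg⟩ := exists_realization hf
    exact ⟨g, f, hinj, hP, hg⟩
  choose! g f hinj hdec hg using h1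
  have htop : ∀ w, D.Good m w → ∃ z, w ∈ D.below z ∧ D.Good m z ∧ ¬ D.Good m (D.par z) := by
    intro w hw
    obtain ⟨y, -, hy, rfl | hin⟩ := exists_mem_insert_twigs hroot (D.mem_root w)
    · exact absurd hw hy
    · obtain ⟨z, hz, hwz⟩ := Set.mem_iUnion₂.1 hin
      exact ⟨z, hwz, hz.2, by rwa [hz.1.2]⟩
  choose! top htop1 htop2 htop3 using htop
  -- A good vertex lies in a unique maximal good branch, with apex `top w`; it is coloured by the
  -- pattern that encodes the second components at the bad parent of that apex.
  let S : V → Prop := fun w => if D.Good m w then g (D.par (top w)) (top w) w else bit w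
  have hSbad : ∀ y, ¬ D.Good m y → S y = bit y := fun y hy => by simp only [S, hy, if_false]
  have hSgood : ∀ y, ¬ D.Good m y → ∀ z ∈ D.kids (D.Good m) y, ∀ w ∈ D.below z,
      S w = g y z w := by
    intro y hy z hz w hw
    have hgw : D.Good m w := hz.2.of_mem hw
    have h2 : top w = z := eq_of_good_tops (htop1 w hgw) hw (htop2 w hgw) hz.2 (htop3 w hgw)
      (by rwa [hz.1.2])
    simp only [S, hgw, if_true]
    rw [h2, hz.1.2]
  have hpar : ∀ y, ¬ D.Good m y → S (D.par y) = bit (D.par y) := fun y hy =>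
    hSbad _ (not_good_of_mem hy (D.mem_par y))
  have hty : ∀ y, ¬ D.Good m y → ∀ z ∈ D.kids (D.Good m) y, D.ty z S = f y z := by
    intro y hy z hz
    rw [← (hg y hy z hz).2.2]
    exact D.ty_congr (hSgood y hy z hz)
  refine ⟨S, ?_, ?_, ?_⟩
  · intro j y
    by_cases hy : D.Good m y
    · simp only [aux, hy, if_true]
      exact ((hc j y).1 hy).symm
    · have h2 : (fun z => D.ty z S) '' D.kids (D.Good m) y = f y '' D.kids (D.Good m) y :=
        Set.image_congr (hty y hy)
      simp only [aux, hy, if_false, h2, hpar y hy, hdec y hy]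
      refine Prod.ext (propext ?_) rfl
      change ind (D.lev y) = j ∧ S y ↔ (c j y).1
      rw [hSbad y hy]
      constructor
      · rintro ⟨rfl, h3⟩
        exact h3
      · intro h3
        have h4 := ((hc j y).2 hy).1 h3
        subst h4
        exact ⟨rfl, h3⟩
  · intro y hy
    rw [hSbad y hy]
  · intro y hy
    refine ⟨fun z hz z' hz' he => ?_, fun z hz => ⟨?_, fun hi => ?_⟩⟩
    · have he : D.ty z S = D.ty z' S := he
      rw [hty y hy z hz, hty y hy z' hz'] at he
      exact hinj y hy hz hz' he
    · exact (hg y hy z hz).1.of_ty_eq ((hg y hy z hz).2.2.trans (hty y hy z hz).symm)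
    · rw [hpar y hy, hSgood y hy z hz z (D.self_mem z)]
      exact (hg y hy z hz).2.1 hi

end Rooted
end AsymTree

/-! ### Sets that break the automorphisms fixing the root -/

namespace AsymTree
namespace Rooted

variable {V : Type u} {D : Rooted V} {m : Cardinal.{u}} {ind : ℕ → ℕ}

theorem two_power_stock_le (j : ℕ) {y : V} (hy : ¬ D.Good m y) :
    2 ^ #(D.stock m y) ≤ #{a // (D.palette m ind j).ok y a} := by
  rw [← Cardinal.mk_set]
  refine Cardinal.mk_le_of_injective (f := fun A => ⟨(False, Subtype.val '' A),
    fun h => absurd h hy, fun _ => ⟨False.elim, by simp⟩⟩) ?_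
  intro A B h
  exact Set.image_injective.2 Subtype.val_injective (congrArg (fun a => a.1.2) h)

theorem exists_two_colors (hind : ∀ j N, ∃ n ≥ N, ind n = j) (j : ℕ) {x : V}
    (hx : ¬ D.Good m x) : ∃ y ∈ D.below x, ¬ D.Good m y ∧
      ∃ a b, (D.palette m ind j).ok y a ∧ (D.palette m ind j).ok y b ∧ a ≠ b := by
  obtain ⟨n, hn, hj⟩ := hind j (D.lev x)
  obtain ⟨y, hy, hgy, hl⟩ := layer_nonempty hx (n - D.lev x)
  have hl : D.lev y = n := by omega
  refine ⟨y, hy, hgy, (True, ∅), (False, ∅), ⟨fun h => absurd h hgy, fun _ => ⟨fun _ => ?_, by simp⟩⟩,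
    ⟨fun h => absurd h hgy, fun _ => ⟨False.elim, by simp⟩⟩, by simp⟩
  rw [hl, hj]

/-- Sequences of types number at least $2^m$ and the degree is at most $2^m$, so isomorphic limbs at
`y` can get different sequences. -/
theorem Admissible.exists_separating_types (hD : D.Admissible m)
    (hind : ∀ j N, ∃ n ≥ N, ind n = j) (idx : ℕ → ℕ) (y : V) :
    ∃ τ : V → ℕ → D.BType (Prop × Set V), Set.InjOn τ (D.limbs m y) ∧
      ∀ z ∈ D.limbs m y, ∀ k, τ z k ∈ (D.palette m ind (idx k)).types z := by
  classical
  have : Nonempty (ℕ → D.BType (Prop × Set V)) := ⟨fun _ => D.ty D.root fun _ => (True, ∅)⟩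
  obtain ⟨ι, h1, h2⟩ := exists_disjoint_selection (D.relSetoid (D.limbs m y))
    (fun z => {v : ℕ → D.BType (Prop × Set V) | ∀ k, v k ∈ (D.palette m ind (idx k)).types z})
    (fun _ => (Set.univ : Set PUnit.{u + 1}))
    (fun z z' h => by
      ext v
      exact forall_congr' fun k => by rw [Palette.types_eq_of_rel _ h])
    (fun z z' q h h' => Palette.rel_of_mem_types (h 0) (h' 0))
    (fun z => by
      rw [Cardinal.sum_const', Cardinal.mk_univ, Cardinal.mk_punit, mul_one]
      refine le_trans ?_ (le_mk_pi_types hD.infinite (fun k => D.palette m ind (idx k))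
        (fun y _ => mk_insert_twigs_le y) (fun k y hy => two_power_stock_le _ hy)
        (fun k x hx => exists_two_colors hind _ hx) z.2.2)
      refine le_trans ?_ (hD.deg y)
      exact ⟨⟨fun w => ⟨w.1, w.1.2.1⟩, fun w w' h =>
        Subtype.ext (Subtype.ext (Subtype.mk.inj h))⟩⟩)
  refine ⟨fun z => if hz : z ∈ D.limbs m y then ι ⟨z, hz⟩ ⟨⟩ else Classical.arbitrary _, ?_, ?_⟩
  · intro z hz z' hz' he
    simp only [hz, hz', dite_true] at he
    exact congrArg Subtype.val (h2 _ _ _ (Set.mem_univ _) _ (Set.mem_univ _) he).1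
  · intro z hz k
    simp only [hz, dite_true]
    exact h1 ⟨z, hz⟩ _ (Set.mem_univ _) k

/-- Branches at different vertices of level `i + 1` are disjoint, so one sequence of colourings
serves all vertices of level `i`. Separate sequences for separate levels avoid any clash between
nested branches. -/
theorem Admissible.exists_separating_colorings (hD : D.Admissible m)
    (hind : ∀ j N, ∃ n ≥ N, ind n = j) (idx : ℕ → ℕ → ℕ) :
    ∃ c : ℕ → ℕ → V → Prop × Set V, (∀ i k w, (D.palette m ind (idx i k)).ok w (c i k w)) ∧
      ∀ y, ∀ z ∈ D.limbs m y, ∀ z' ∈ D.limbs m y,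
        (∀ k, D.ty z (c (D.lev y) k) = D.ty z' (c (D.lev y) k)) → z = z' := by
  classical
  choose τ hinj hτ using fun y => hD.exists_separating_types (m := m) hind (idx (D.lev y)) y
  have h1 : ∀ z, ¬ D.Good m z ∧ z ≠ D.root → ∀ k, ∃ c : V → Prop × Set V,
      (∀ w, (D.palette m ind (idx (D.lev (D.par z)) k)).ok w (c w)) ∧
        D.ty z c = τ (D.par z) z k := fun z hz k => hτ (D.par z) z ⟨⟨hz.2, rfl⟩, hz.1⟩ k
  choose! g hg hgτ using h1
  choose d hd using fun j => (D.palette m ind j).nonempty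
  refine ⟨fun i k w => if ¬ D.Good m (D.anc (i + 1) w) ∧ i + 1 ≤ D.lev w
    then g (D.anc (i + 1) w) k w else d (idx i k) w, fun i k w => ?_, ?_⟩
  · by_cases hw : ¬ D.Good m (D.anc (i + 1) w) ∧ i + 1 ≤ D.lev w
    · simp only [hw, if_true, not_false_eq_true, and_self]
      have hl := D.lev_anc hw.2
      have hne : D.anc (i + 1) w ≠ D.root := by
        rw [Ne, ← lev_eq_zero, hl]
        omega
      have h2 := hg _ ⟨hw.1, hne⟩ k w
      rwa [lev_par, hl] at h2
    · simp only [hw, if_false]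
      exact hd _ w
  · intro y z hz z' hz' he
    have key : ∀ z ∈ D.limbs m y, ∀ k, D.ty z (fun w =>
        if ¬ D.Good m (D.anc (D.lev y + 1) w) ∧ D.lev y + 1 ≤ D.lev w
        then g (D.anc (D.lev y + 1) w) k w else d (idx (D.lev y) k) w) = τ y z k := by
      intro z hz k
      have h2 := hgτ z ⟨hz.2, hz.1.1⟩ k
      rw [hz.1.2] at h2
      rw [← h2]
      refine D.ty_congr fun w hw => ?_
      have h3 := D.anc_eq_of_isChild hz.1 hw
      have h4 := D.lev_le hw
      rw [IsChild.lev D hz.1] at h4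
      rw [h3, if_pos ⟨hz.2, h4⟩]
    refine hinj y hz hz' ?_
    funext k
    rw [← key z hz k, ← key z' hz' k]
    exact he k

/-- Colouring `j` is free on the bits of `E` and on all stocks. These make up the size of the tree,
since the bad vertices outside `E` contribute only a factor `ℵ₀`. -/
theorem le_mk_free_colorings (hroot : ¬ D.Good m D.root) (hind : ∀ j N, ∃ n ≥ N, ind n = j)
    (j : ℕ) : 2 ^ #V ≤ #{c : V → Prop × Set V // ∀ w, (D.palette m ind j).ok w (c w)} := by
  classical
  let R : Set V := {y | ¬ D.Good m y}
  let E : Set V := {y | ¬ D.Good m y ∧ ind (D.lev y) = j}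
  let Y := E ⊕ (Σ y : R, D.stock m y)
  have h1 : #(Set Y) ≤ #{c : V → Prop × Set V // ∀ w, (D.palette m ind j).ok w (c w)} := by
    refine Cardinal.mk_le_of_injective (f := fun H => ⟨fun y => if D.Good m y then (False, ∅) else
      (∃ hy : y ∈ E, Sum.inl ⟨y, hy⟩ ∈ H,
        {a | ∃ (hy : y ∈ R) (ha : a ∈ D.stock m y), Sum.inr ⟨⟨y, hy⟩, ⟨a, ha⟩⟩ ∈ H}), fun w => ?_⟩) ?_
    · by_cases hw : D.Good m w
      · simp only [hw, if_true]
        exact ⟨fun _ => rfl, fun h => absurd hw h⟩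
      · simp only [hw, if_false]
        refine ⟨fun h => absurd h hw, fun _ => ⟨?_, ?_⟩⟩
        · rintro ⟨h, _⟩
          exact h.2
        · rintro a ⟨_, ha, _⟩
          exact ha
    · intro H H' he
      have he := fun y => congrFun (Subtype.mk.inj he) y
      ext p
      rcases p with ⟨y, hy⟩ | ⟨⟨y, hy⟩, ⟨a, ha⟩⟩
      · have h2 := he y
        rw [if_neg hy.1, if_neg hy.1] at h2
        have h3 := Iff.of_eq (Prod.mk.inj h2).1
        constructor
        · intro h
          obtain ⟨_, h4⟩ := h3.mp ⟨hy, h⟩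
          exact h4
        · intro h
          obtain ⟨_, h4⟩ := h3.mpr ⟨hy, h⟩
          exact h4
      · have h2 := he y
        rw [if_neg hy, if_neg hy] at h2
        have h3 := Set.ext_iff.1 (Prod.mk.inj h2).2 a
        constructor
        · intro h
          obtain ⟨_, _, h4⟩ := h3.1 ⟨hy, ha, h⟩
          exact h4
        · intro h
          obtain ⟨_, _, h4⟩ := h3.2 ⟨hy, ha, h⟩
          exact h4
  refine le_trans ?_ h1
  rw [Cardinal.mk_set]
  refine Cardinal.power_le_power_left two_ne_zero ?_
  have hY : #Y = #E + Cardinal.sum fun y : R => #(D.stock m y) := by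
    simp only [Y, Cardinal.mk_sum, Cardinal.mk_sigma, Cardinal.lift_id]
  have hd : ∀ y : R, ∃ z, z ∈ D.below y ∧ z ∈ E := by
    rintro ⟨y, hy⟩
    obtain ⟨n, hn, hj⟩ := hind j (D.lev y)
    obtain ⟨z, hz, hgz, hl⟩ := layer_nonempty hy (n - D.lev y)
    have hl : D.lev z = n := by omega
    exact ⟨z, hz, hgz, by rw [hl, hj]⟩
  -- Every bad vertex has a descendant in `E` and is determined by it together with its own level.
  have hR : #R ≤ #E * ℵ₀ := by
    choose d hd hdE using hd
    have h2 : #(E × ULift.{u} ℕ) = #E * ℵ₀ := by simp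
    rw [← h2]
    refine Cardinal.mk_le_of_injective
      (f := fun y => ((⟨d y, hdE y⟩ : E), (⟨D.lev y⟩ : ULift.{u} ℕ))) ?_
    intro y y' he
    simp only [Prod.mk.injEq, Subtype.mk.injEq, ULift.up.injEq] at he
    refine Subtype.ext (D.eq_of_mem_of_mem (hd y) ?_ he.2)
    rw [he.1]
    exact hd y'
  have hE : ℵ₀ ≤ #E := by
    rw [Cardinal.aleph0_le_mk_iff, Set.infinite_coe_iff]
    intro hfin
    obtain ⟨N, hN⟩ := (hfin.image D.lev).bddAbove
    obtain ⟨n, hn, hj⟩ := hind j (N + 1)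
    obtain ⟨z, hz, hgz, hl⟩ := layer_nonempty hroot n
    have h2 := hN (Set.mem_image_of_mem _ (⟨hgz, by rw [hl, D.lev_root, zero_add, hj]⟩ : z ∈ E))
    rw [hl, D.lev_root] at h2
    omega
  have hV : #V ≤ ℵ₀ * Cardinal.sum fun y : R => 1 + #(D.stock m y) := by
    have h0 := sum_mul_left ℵ₀ fun y : R => 1 + #(D.stock m y)
    rw [Cardinal.lift_id] at h0
    rw [← Cardinal.mk_univ, ← h0]
    have h2 : (Set.univ : Set V) ⊆ ⋃ y : R, insert y.1 (D.twigs m y) := by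
      intro w _
      obtain ⟨y, -, hy, hin⟩ := exists_mem_insert_twigs hroot (D.mem_root w)
      exact Set.mem_iUnion.2 ⟨⟨y, hy⟩, hin⟩
    refine (Cardinal.mk_le_mk_of_subset h2).trans (Cardinal.mk_iUnion_le_sum_mk.trans ?_)
    exact Cardinal.sum_le_sum _ _ fun y => mk_insert_twigs_le y.1
  have hYinf : ℵ₀ ≤ #Y := by
    rw [hY]
    exact hE.trans (self_le_add_right _ _)
  refine hV.trans ?_
  have h3 : (Cardinal.sum fun y : R => 1 + #(D.stock m y)) ≤ #Y := by
    rw [Cardinal.sum_add_distrib', Cardinal.sum_const', mul_one, hY]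
    refine add_le_add_left (hR.trans ?_) _
    rw [Cardinal.mul_aleph0_eq hE]
  refine (mul_le_mul_right h3 _).trans ?_
  rw [Cardinal.aleph0_mul_eq hYinf]

/-- A rooted tree whose root is not good has `2 ^ #V` vertex sets which are pairwise inequivalent
and asymmetrizing with respect to the automorphisms that fix the root.  On those vertices which are
not good the sets can be prescribed on the levels `n` with `ind n = 1`. -/
theorem Admissible.exists_family (hD : D.Admissible m) (hroot : ¬ D.Good m D.root)
    (hind : ∀ j N, ∃ n ≥ N, ind n = j) (pat : ℕ → Prop) :
    ∃ (H : Type u) (S : H → V → Prop), 2 ^ #V ≤ #H ∧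
      (∀ h h' e e', D.IsIso e e' D.root D.root → (∀ y, S h' (e y) = S h y) →
        h = h' ∧ ∀ y, e y = y) ∧
      (∀ h y, ¬ D.Good m y → ind (D.lev y) = 1 → (S h y ↔ pat (D.lev y))) ∧
      ∀ h y z, ¬ D.Good m y → D.IsChild z y → D.Good m z → ℵ₀ ≤ #(D.below z) →
        (S h z ↔ ¬ S h (D.par y)) := by
  classical
  obtain ⟨c, hc, hsep⟩ := hD.exists_separating_colorings hind fun i k => Nat.pair i k + 2
  -- Colouring 0 is the free parameter, colouring 1 carries the prescribed pattern, and colouring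
  -- `Nat.pair i k + 2` is the `k`-th one separating limbs at level `i`.
  let C : {c : V → Prop × Set V // ∀ w, (D.palette m ind 0).ok w (c w)} → ℕ → V → Prop × Set V :=
    fun h j => match j with
      | 0 => h.1
      | 1 => fun y => if D.Good m y then (False, ∅) else (ind (D.lev y) = 1 ∧ pat (D.lev y), ∅)
      | j + 2 => c j.unpair.1 j.unpair.2
  have hC : ∀ h j w, (D.palette m ind j).ok w (C h j w) := by
    intro h j w
    match j with
    | 0 => exact h.2 w
    | 1 =>
      by_cases hw : D.Good m w
      · simp only [C, hw, if_true]
        exact ⟨fun _ => rfl, fun h => absurd hw h⟩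
      · simp only [C, hw, if_false]
        exact ⟨fun h => absurd h hw, fun _ => ⟨And.left, by simp⟩⟩
    | j + 2 =>
      have h1 := hc j.unpair.1 j.unpair.2 w
      rwa [Nat.pair_unpair] at h1
  choose S hS hbit hkids using fun h => hD.exists_aux_eq hroot ind (hC h)
  refine ⟨_, S, le_mk_free_colorings hroot hind 0, ?_, ?_, ?_⟩
  · intro h h' e e' he hSe
    have haux : ∀ j y, C h' j (e y) = C h j y := by
      intro j y
      rw [← hS h', ← hS h]
      exact aux_map ind he hSe j y
    -- Bad vertices are fixed level by level, by the colourings that separate limbs. Only then is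
    -- the free parameter compared, at fixed vertices; good vertices follow from the rigid, pairwise
    -- different types on the twigs.
    have hfix : ∀ y, ¬ D.Good m y → e y = y := by
      have key : ∀ n : ℕ, ∀ y, ¬ D.Good m y → D.lev y = n → e y = y := by
        intro n
        induction n with
        | zero =>
          intro y _ hl
          rw [lev_eq_zero] at hl
          rw [hl, he.apex]
        | succ n ih =>
          intro y hy hl
          have hne : y ≠ D.root := by
            rw [Ne, ← lev_eq_zero]
            omega
          have hlp : D.lev (D.par y) = n := by rw [lev_par]; omega
          have hp := ih (D.par y) (not_good_of_mem hy (D.mem_par y)) hlp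
          have hch := D.isChild_par (D.mem_root y) hne
          have hch' := he.isChild (D.mem_root _) hch
          rw [hp] at hch'
          have hgy : ¬ D.Good m (e y) := fun hg => hy (hg.of_rel (he.rel (D.mem_root y)).symm)
          refine (hsep (D.par y) y ⟨hch, hy⟩ (e y) ⟨hch', hgy⟩ fun k => ?_).symm
          refine D.ty_eq_iff.2 ⟨e, e', he.restrict (D.mem_root y), fun w _ => ?_⟩
          have h1 := haux (Nat.pair (D.lev (D.par y)) k + 2) w
          simpa only [C, Nat.unpair_pair] using h1
      exact fun y hy => key _ y hy rfl
    have hh : h = h' := by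
      apply Subtype.ext
      funext y
      by_cases hy : D.Good m y
      · rw [(h.2 y).1 hy, (h'.2 y).1 hy]
      · have h1 := haux 0 y
        rw [hfix y hy] at h1
        exact h1.symm
    subst hh
    refine ⟨rfl, fun y => he.eq_of_fixes_steps (fun y hy hne hp => ?_) y (D.mem_root y)⟩
    by_cases hgy : D.Good m y
    · by_cases hgp : D.Good m (D.par y)
      · obtain ⟨x, -, hx, hin⟩ := exists_mem_insert_twigs hroot (D.mem_root y)
        rcases hin with rfl | hin
        · exact absurd hgy hx
        · obtain ⟨z, hz, hyz⟩ := Set.mem_iUnion₂.1 hin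
          have hzi := he.restrict (D.mem_root z)
          have hzc := he.isChild (D.mem_root x) hz.1
          rw [hfix x hx] at hzc
          have hze : e z = z := by
            refine ((hkids h x hx).1 hz ⟨hzc, hz.2.of_rel (he.rel (D.mem_root z))⟩ ?_).symm
            exact D.ty_eq_iff.2 ⟨e, e', hzi, fun w _ => hSe w⟩
          rw [hze] at hzi
          exact ((hkids h x hx).2 z hz).1 e e' hzi (fun w _ => hSe w) y hyz
      · have hch := D.isChild_par hy hne
        have hch' := he.isChild (D.mem_root _) hch
        rw [hp] at hch'
        refine ((hkids h (D.par y) hgp).1 ⟨hch, hgy⟩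
          ⟨hch', hgy.of_rel (he.rel (D.mem_root y))⟩ ?_).symm
        exact D.ty_eq_iff.2 ⟨e, e', he.restrict (D.mem_root y), fun w _ => hSe w⟩
    · exact hfix y hgy
  · intro h y hy hl
    rw [hbit h y hy, hl]
    simp only [C, hy, if_false, hl, true_and]
  · intro h y z hy hz hgz hi
    exact ((hkids h y hy).2 z ⟨hz, hgz⟩).2 hi

end Rooted
end AsymTree

/-! ### Rooting a tree at a vertex -/

namespace AsymTree

open Rooted

variable {V : Type u} {T : SimpleGraph V}

theorem exists_parent (hT : T.IsTree) (r : V) {x : V} (hx : x ≠ r) :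
    ∃ y, T.Adj x y ∧ T.dist r x = T.dist r y + 1 := by
  obtain ⟨p, hp⟩ := hT.connected.exists_walk_length_eq_dist x r
  cases p with
  | nil => exact absurd rfl hx
  | @cons _ y _ h q =>
    refine ⟨y, h, ?_⟩
    rw [SimpleGraph.Walk.length_cons, T.dist_comm] at hp
    have h1 := T.dist_le q
    rw [T.dist_comm] at h1
    rcases hT.dist_eq_dist_add_one_of_adj r h with h2 | h2 <;> omega

theorem parent_unique (hT : T.IsTree) (r : V) {x y y' : V} (h : T.Adj x y)
    (hd : T.dist r x = T.dist r y + 1) (h' : T.Adj x y') (hd' : T.dist r x = T.dist r y' + 1) :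
    y = y' := by
  classical
  obtain ⟨q, hq, -⟩ := hT.connected.exists_path_of_dist r x
  have key : ∀ y, T.Adj x y → T.dist r x = T.dist r y + 1 → y = q.penultimate := by
    intro y h hd
    refine hT.isAcyclic.eq_penultimate_of_adj_end hq h ?_
    by_contra hy
    obtain ⟨p, hp, hpl⟩ := hT.connected.exists_path_of_dist r y
    have h1 := hT.isAcyclic.mem_support_of_ne_mem_support_of_adj_of_isPath hp hq h.symm hy
    have h2 := T.dist_le (p.takeUntil x h1)
    have h3 := p.length_takeUntil_le_length h1
    omega
  rw [key y h hd, key y' h' hd']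

open Classical in
/-- The tree `T` rooted at `r`. -/
noncomputable def rootedAt (hT : T.IsTree) (r : V) : Rooted V where
  root := r
  par x := if h : x ≠ r then (exists_parent hT r h).choose else r
  lev x := T.dist r x
  par_root := by simp
  lev_root := by simp
  lev_eq x hx := by
    simp only [hx, Ne, not_false_eq_true, dite_true]
    exact (exists_parent hT r hx).choose_spec.2

@[simp] theorem rootedAt_root (hT : T.IsTree) (r : V) : (rootedAt hT r).root = r := rfl

theorem rootedAt_lev (hT : T.IsTree) (r x : V) : (rootedAt hT r).lev x = T.dist r x := rfl

theorem adj_par (hT : T.IsTree) {r x : V} (hx : x ≠ r) : T.Adj x ((rootedAt hT r).par x) := by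
  simp only [rootedAt, hx, Ne, not_false_eq_true, dite_true]
  exact (exists_parent hT r hx).choose_spec.1

theorem par_eq (hT : T.IsTree) {r x y : V} (h : T.Adj x y) (hd : T.dist r x = T.dist r y + 1) :
    (rootedAt hT r).par x = y := by
  have hx : x ≠ r := by
    rintro rfl
    simp at hd
  exact parent_unique hT r (adj_par hT hx) ((rootedAt hT r).lev_eq x hx) h hd

theorem adj_of_isChild (hT : T.IsTree) {r z y : V} (h : (rootedAt hT r).IsChild z y) : T.Adj y z := by
  rw [← h.2]
  exact (adj_par hT h.1).symm

theorem isChild_of_dist (hT : T.IsTree) {r z y : V} (h : T.Adj y z)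
    (hd : T.dist r z = T.dist r y + 1) : (rootedAt hT r).IsChild z y := by
  refine ⟨?_, par_eq hT h.symm hd⟩
  rintro rfl
  simp at hd

theorem isChild_or_isChild (hT : T.IsTree) (r : V) {x y : V} (h : T.Adj x y) :
    (rootedAt hT r).IsChild x y ∨ (rootedAt hT r).IsChild y x := by
  rcases hT.dist_eq_dist_add_one_of_adj r h with h1 | h1
  · exact Or.inl (isChild_of_dist hT h.symm h1)
  · exact Or.inr (isChild_of_dist hT h h1)

theorem isChild_of_adj_of_ne (hT : T.IsTree) {r x y : V} (h : T.Adj x y)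
    (hne : y ≠ (rootedAt hT r).par x) : (rootedAt hT r).IsChild y x := by
  rcases isChild_or_isChild hT r h with h1 | h1
  · exact absurd h1.2.symm hne
  · exact h1

theorem isChild_root_iff (hT : T.IsTree) {r y : V} :
    (rootedAt hT r).IsChild y r ↔ T.Adj r y := by
  refine ⟨fun h => adj_of_isChild hT h, fun h => isChild_of_dist hT h ?_⟩
  rw [SimpleGraph.dist_eq_one_iff_adj.2 h, SimpleGraph.dist_self]

variable (T) in
/-- The component of `y` after deletion of the edge `x y`. -/
def side (x y : V) : Set V := {w | T.dist w y < T.dist w x}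

/-- This describes branches without reference to the root, which permits a change of root. -/
theorem below_eq_side (hT : T.IsTree) {r x y : V} (h : (rootedAt hT r).IsChild y x) :
    (rootedAt hT r).below y = side T x y := by
  set D := rootedAt hT r with hD
  have hle : ∀ n : ℕ, ∀ w, T.dist w (D.par^[n] w) ≤ n := by
    intro n
    induction n with
    | zero => simp
    | succ n ih =>
      intro w
      rw [Function.iterate_succ_apply']
      refine (hT.connected.dist_triangle (v := D.par^[n] w)).trans (add_le_add (ih w) ?_)
      by_cases hr : D.par^[n] w = r
      · have : D.par r = r := D.par_root
        rw [hr, this]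
        simp
      · exact (SimpleGraph.dist_eq_one_iff_adj.2 (adj_par hT hr)).le
  have hlev := IsChild.lev D h
  rw [rootedAt_lev, rootedAt_lev] at hlev
  have hsub : D.below y ⊆ side T x y := by
    intro w hw
    obtain ⟨h1, h2⟩ := D.mem_below_iff.1 hw
    have h3 := hle (D.lev w - D.lev y) w
    rw [anc] at h2
    rw [h2] at h3
    rw [rootedAt_lev, rootedAt_lev] at h3 h1
    have h4 := hT.connected.dist_triangle (u := r) (v := x) (w := w)
    rw [T.dist_comm (u := x)] at h4
    change T.dist w y < T.dist w x
    omega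
  refine hsub.antisymm fun w hw => ?_
  by_contra hn
  obtain ⟨p, hp⟩ := hT.connected.exists_walk_length_eq_dist w y
  -- The branch can only be entered along the edge from `x` to `y`, so a shortest walk from `w` to
  -- `y` passes through `x`, against `w` being closer to `y`.
  obtain ⟨d, hd, hd1, hd2⟩ := p.exists_boundary_dart (D.below y)ᶜ hn (by simp [D.self_mem])
  have hd2 : d.snd ∈ D.below y := by simpa using hd2
  have hd1 : d.fst ∉ D.below y := hd1
  have hy : d.snd = y ∧ d.fst = x := by
    rcases isChild_or_isChild hT r d.adj with h1 | h1
    · exact absurd (D.mem_trans (IsChild.mem D h1) hd2) hd1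
    · have h2 : d.snd = y := by
        by_contra hne
        have := D.par_mem hd2 hne
        rw [h1.2] at this
        exact hd1 this
      refine ⟨h2, ?_⟩
      rw [← h1.2, h2, ← h.2]
  have hx : x ∈ p.support := hy.2 ▸ p.dart_fst_mem_support_of_mem_darts hd
  classical
  have h1 := T.dist_le (p.takeUntil x hx)
  have h2 := p.length_takeUntil_le_length hx
  have hw : T.dist w y < T.dist w x := hw
  omega

theorem compl_side (hT : T.IsTree) {x y : V} (h : T.Adj x y) : (side T x y)ᶜ = side T y x := by
  ext w
  have := hT.dist_ne_of_adj w h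
  simp only [side, Set.mem_compl_iff, Set.mem_ofPred_eq]
  omega

theorem dist_map (hT : T.IsTree) (φ : T ≃g T) (x y : V) : T.dist (φ x) (φ y) = T.dist x y := by
  have key : ∀ (φ : T ≃g T) (x y : V), T.dist (φ x) (φ y) ≤ T.dist x y := by
    intro φ x y
    obtain ⟨p, hp⟩ := hT.connected.exists_walk_length_eq_dist x y
    rw [← hp, ← SimpleGraph.Walk.length_map φ.toHom p]
    exact T.dist_le _
  refine (key φ x y).antisymm ?_
  have := key φ.symm (φ x) (φ y)
  simpa using this

theorem mem_side_map (hT : T.IsTree) (φ : T ≃g T) (x y w : V) :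
    φ w ∈ side T (φ x) (φ y) ↔ w ∈ side T x y := by
  simp [side, dist_map hT]

theorem mk_side_map (hT : T.IsTree) (φ : T ≃g T) (x y : V) :
    #(side T (φ x) (φ y)) = #(side T x y) := by
  refine (Cardinal.mk_congr (φ.toEquiv.subtypeEquiv fun w => ?_)).symm
  exact (mem_side_map hT φ x y w).symm

theorem isIso_of_fixes (hT : T.IsTree) {r : V} (φ : T ≃g T) (hr : φ r = r) :
    (rootedAt hT r).IsIso φ φ.symm r r := by
  have hb : (rootedAt hT r).below r = Set.univ := (rootedAt hT r).below_root
  have hlev : ∀ y, T.dist r (φ y) = T.dist r y := fun y => by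
    have := dist_map hT φ r y
    rwa [hr] at this
  refine ⟨by simp [hb], by simp [hb], by simp, by simp, hr, fun y _ hne => ?_, fun y _ => hlev y⟩
  refine par_eq hT (φ.map_adj_iff.2 (adj_par hT hne)) ?_
  rw [hlev, hlev]
  exact (rootedAt hT r).lev_eq y hne

variable {m : Cardinal.{u}}

/-- Exchanging two isomorphic sibling branches and fixing everything else is an automorphism. If the
branches had size less than `m`, so would their union, contradicting the motion. -/
theorem admissible_rootedAt (hT : T.IsTree) (hm : ℵ₀ ≤ m)
    (hdeg : ∀ v : V, #(T.neighborSet v) ≤ 2 ^ m) (hmot : MotionAtLeast T m) (r : V) :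
    (rootedAt hT r).Admissible m := by
  classical
  refine ⟨hm, fun y => le_trans ?_ (hdeg y), ?_⟩
  · exact Cardinal.mk_le_of_injective (f := fun z => ⟨z.1, adj_of_isChild hT z.2⟩)
      fun z z' h => Subtype.ext (Subtype.mk.inj h)
  intro y z z' hz hz' hne hrel
  obtain ⟨e, e', h⟩ := hrel
  set D := rootedAt hT r with hD
  have hdisj : ∀ w, w ∈ D.below z → w ∉ D.below z' := fun w hw hw' =>
    hne (D.child_eq_of_mem hz hz' hw hw')
  let ψ : V → V := fun w => if w ∈ D.below z then e w else if w ∈ D.below z' then e' w else w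
  have h1 : ∀ w ∈ D.below z, ψ w = e w := fun w hw => by simp [ψ, hw]
  have h2 : ∀ w ∈ D.below z', ψ w = e' w := fun w hw => by
    have : w ∉ D.below z := fun h => hdisj w h hw
    simp [ψ, hw, this]
  have h3 : ∀ w, w ∉ D.below z → w ∉ D.below z' → ψ w = w := fun w hw hw' => by
    simp [ψ, hw, hw']
  have hinv : ∀ w, ψ (ψ w) = w := by
    intro w
    by_cases hw : w ∈ D.below z
    · rw [h1 w hw, h2 _ (h.maps w hw), h.inv w hw]
    · by_cases hw' : w ∈ D.below z'
      · rw [h2 w hw', h1 _ (h.maps' w hw'), h.inv' w hw']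
      · rw [h3 w hw hw', h3 w hw hw']
  have hym : y ∉ D.below z := IsChild.not_mem D hz
  have hym' : y ∉ D.below z' := IsChild.not_mem D hz'
  have hchild : ∀ a b, D.IsChild a b → T.Adj (ψ b) (ψ a) := by
    have hside : ∀ (z z' : V) (e e' : V → V), D.IsIso e e' z z' → D.IsChild z y → D.IsChild z' y →
        (∀ w ∈ D.below z, ψ w = e w) → ∀ a b, D.IsChild a b → a ∈ D.below z →
          T.Adj (ψ b) (ψ a) := by
      intro z z' e e' h hz hz' h1 a b hab ha
      by_cases hne : a = z
      · subst hne
        have hby : b = y := by rw [← hab.2, hz.2]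
        rw [hby, h3 y hym hym', h1 a ha, h.apex]
        exact adj_of_isChild hT hz'
      · have hp := D.par_mem ha hne
        rw [hab.2] at hp
        rw [h1 a ha, h1 b hp]
        exact adj_of_isChild hT (h.isChild hp hab)
    intro a b hab
    by_cases ha : a ∈ D.below z
    · exact hside z z' e e' h hz hz' h1 a b hab ha
    · by_cases ha' : a ∈ D.below z'
      · exact hside z' z e' e h.symm hz' hz h2 a b hab ha'
      · have hm := IsChild.mem D hab
        rw [h3 a ha ha', h3 b (fun hb => ha (D.mem_trans hm hb)) fun hb => ha' (D.mem_trans hm hb)]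
        exact adj_of_isChild hT hab
  have hadj : ∀ a b, T.Adj a b → T.Adj (ψ a) (ψ b) := by
    intro a b hab
    rcases isChild_or_isChild hT r hab with h4 | h4
    · exact (hchild a b h4).symm
    · exact hchild b a h4
  let φ : T ≃g T :=
    { toFun := ψ
      invFun := ψ
      left_inv := hinv
      right_inv := hinv
      map_rel_iff' := by
        intro a b
        refine ⟨fun hab => ?_, hadj a b⟩
        have h5 := hadj _ _ hab
        simpa [hinv] using h5 }
  have hφ : ∀ w, φ w = ψ w := fun _ => rfl
  have hφne : φ ≠ RelIso.refl T.Adj := by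
    intro hc
    have h5 : φ z = z := by rw [hc]; rfl
    rw [hφ, h1 z (D.self_mem z), h.apex] at h5
    exact hne h5.symm
  have h4 := hmot φ hφne
  by_contra! hlt
  have h5 : {v | φ v ≠ v} ⊆ D.below z ∪ D.below z' := by
    intro w hw
    by_contra hn
    rw [Set.mem_union, not_or] at hn
    exact hw (h3 w hn.1 hn.2)
  have h6 := (h4.trans (Cardinal.mk_le_mk_of_subset h5)).trans (Cardinal.mk_union_le _ _)
  rw [← h.mk_below] at h6
  exact absurd h6 (Cardinal.add_lt_of_lt hm hlt hlt).not_ge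

end AsymTree

/-! ### Goodness of darts, ranks and the centre of a good tree -/

namespace AsymTree

open Rooted

variable {V : Type u} {T : SimpleGraph V} {m : Cardinal.{u}}

variable (T m) in
/-- Continuation of a dart by a further dart, without turning back, to a branch of size at
least `m`. -/
def Next (q p : V × V) : Prop :=
  q.1 = p.2 ∧ T.Adj q.1 q.2 ∧ q.2 ≠ p.1 ∧ m ≤ #(side T q.1 q.2)

/-- Darts make goodness independent of the root, hence invariant under automorphisms that move the
root. -/
theorem good_iff_acc (hT : T.IsTree) {r x y : V} (h : (rootedAt hT r).IsChild x y) :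
    (rootedAt hT r).Good m x ↔ Acc (Next T m) (y, x) := by
  set D := rootedAt hT r with hD
  constructor
  · intro hg
    induction hg generalizing y with
    | intro x _ ih =>
      constructor
      rintro ⟨a, b⟩ ⟨h1, h2, h3, h4⟩
      dsimp only at h1 h2 h3 h4
      subst h1
      have hb : D.IsChild b a := isChild_of_adj_of_ne hT h2 (by rwa [← hD, h.2])
      exact ih b ⟨hb, by rwa [below_eq_side hT hb]⟩ hb
  · intro hacc
    generalize hp : (y, x) = p at hacc
    induction hacc generalizing x y with
    | intro p _ ih =>
      subst hp
      constructor
      rintro z ⟨hz, hbig⟩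
      refine ih (x, z) ⟨rfl, adj_of_isChild hT hz, ?_, ?_⟩ hz rfl
      · intro hc
        have hc : z = y := hc
        subst hc
        have h1 := IsChild.lev D hz
        have h2 := IsChild.lev D h
        omega
      · rwa [below_eq_side hT hz] at hbig

theorem Next.map (hT : T.IsTree) (φ : T ≃g T) {p q : V × V} (h : Next T m q p) :
    Next T m (φ q.1, φ q.2) (φ p.1, φ p.2) :=
  ⟨by rw [h.1], φ.map_adj_iff.2 h.2.1, fun hc => h.2.2.1 (φ.injective hc), by
    rw [mk_side_map hT]; exact h.2.2.2⟩

theorem Next.exists_of_map (hT : T.IsTree) (φ : T ≃g T) {p q : V × V}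
    (h : Next T m q (φ p.1, φ p.2)) : ∃ q', Next T m q' p ∧ q = (φ q'.1, φ q'.2) := by
  refine ⟨(φ.symm q.1, φ.symm q.2), ?_, by simp⟩
  have := Next.map hT φ.symm h
  simpa using this

theorem acc_map (hT : T.IsTree) (φ : T ≃g T) {p : V × V} (h : Acc (Next T m) p) :
    Acc (Next T m) (φ p.1, φ p.2) := by
  induction h with
  | intro p _ ih =>
    constructor
    intro q hq
    obtain ⟨q', hq', rfl⟩ := Next.exists_of_map hT φ hq
    exact ih q' hq'

theorem acc_map_iff (hT : T.IsTree) (φ : T ≃g T) {x y : V} :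
    Acc (Next T m) (φ x, φ y) ↔ Acc (Next T m) (x, y) := by
  refine ⟨fun h => ?_, fun h => acc_map hT φ h⟩
  simpa using acc_map hT φ.symm h

/-- If the tree is good with respect to one root, then every dart is good. -/
theorem wellFounded_of_good (hT : T.IsTree) {r : V} (hr : (rootedAt hT r).Good m r) :
    WellFounded (Next T m) := by
  set D := rootedAt hT r with hD
  have hdown : ∀ x y, D.IsChild y x → Acc (Next T m) (x, y) := fun x y h =>
    (good_iff_acc hT h).1 (hr.of_mem (D.mem_root y))
  -- A path towards the root must turn away from it after finitely many steps, and from then on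
  -- goodness at `r` applies.
  have hup : ∀ n : ℕ, ∀ x y, D.lev y = n → D.IsChild x y → Acc (Next T m) (x, y) := by
    intro n
    induction n with
    | zero =>
      intro x y hl h
      constructor
      rintro ⟨a, b⟩ ⟨h1, h2, h3, -⟩
      dsimp only at h1 h2 h3
      subst h1
      rcases isChild_or_isChild hT r h2 with h4 | h4
      · have := IsChild.lev D h4
        omega
      · exact hdown _ _ h4
    | succ n ih =>
      intro x y hl h
      constructor
      rintro ⟨a, b⟩ ⟨h1, h2, h3, -⟩
      dsimp only at h1 h2 h3
      subst h1
      rcases isChild_or_isChild hT r h2 with h4 | h4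
      · have := IsChild.lev D h4
        exact ih _ _ (by omega) h4
      · exact hdown _ _ h4
  have hadj : ∀ x y, T.Adj x y → Acc (Next T m) (x, y) := by
    intro x y h
    rcases isChild_or_isChild hT r h with h1 | h1
    · exact hup _ _ _ rfl h1
    · exact hdown _ _ h1
  exact ⟨fun p => ⟨p, fun q hq => hadj _ _ hq.2.1⟩⟩

theorem good_of_wellFounded (hT : T.IsTree) (h : WellFounded (Next T m)) (r : V) :
    (rootedAt hT r).Good m r :=
  good_of_children fun _ hz => (good_iff_acc hT hz).2 (h.apply _)

/-- The degenerate dart `(v, v)` represents the vertex `v`: it is continued by all darts leaving `v`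
into branches of size at least `m`. Its rank is thus a rank of `v`. -/
theorem next_self_iff {v : V} {q : V × V} :
    Next T m q (v, v) ↔ q.1 = v ∧ T.Adj v q.2 ∧ m ≤ #(side T v q.2) := by
  constructor
  · rintro ⟨h1, h2, -, h4⟩
    dsimp only at h1
    rw [h1] at h2 h4
    exact ⟨h1, h2, h4⟩
  · rintro ⟨h1, h2, h3⟩
    exact ⟨h1, by rwa [h1], h2.ne', by rwa [h1]⟩

section Center

variable [IsWellFounded (V × V) (Next T m)]

theorem rank_le_of_forall_lt {p : V × V} {α : Ordinal.{u}}
    (h : ∀ q, Next T m q p → IsWellFounded.rank (Next T m) q < α) :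
    IsWellFounded.rank (Next T m) p ≤ α := by
  rw [IsWellFounded.rank_eq]
  exact Ordinal.iSup_le fun q => Order.succ_le_of_lt (h q.1 q.2)

theorem rank_map_le (hT : T.IsTree) (φ : T ≃g T) (p : V × V) :
    IsWellFounded.rank (Next T m) (φ p.1, φ p.2) ≤ IsWellFounded.rank (Next T m) p := by
  induction p using IsWellFounded.induction (Next T m) with
  | _ p ih =>
    refine rank_le_of_forall_lt fun q hq => ?_
    obtain ⟨q', hq', rfl⟩ := Next.exists_of_map hT φ hq
    exact (ih q' hq').trans_lt (IsWellFounded.rank_lt_of_rel hq')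

theorem rank_lt_of_mem_below (hT : T.IsTree) {r x w : V}
    (hw : w ∈ (rootedAt hT r).below x) (hne : w ≠ x)
    (hbig : m ≤ #((rootedAt hT r).below w)) :
    IsWellFounded.rank (Next T m) ((rootedAt hT r).par w, w) <
      IsWellFounded.rank (Next T m) ((rootedAt hT r).par x, x) := by
  set D := rootedAt hT r with hD
  have key : ∀ n : ℕ, ∀ w, w ∈ D.below x → w ≠ x → D.lev w = n → m ≤ #(D.below w) →
      IsWellFounded.rank (Next T m) (D.par w, w) < IsWellFounded.rank (Next T m) (D.par x, x) := by
    intro n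
    induction n with
    | zero =>
      intro w hw hne hl
      have := D.lev_lt hw hne
      omega
    | succ n ih =>
      intro w hw hne hl hbig
      have hc := D.isChild_par hw hne
      have hp := D.par_mem hw hne
      have hnext : Next T m (D.par w, w) (D.par (D.par w), D.par w) := by
        refine ⟨rfl, adj_of_isChild hT hc, ?_, by rwa [← below_eq_side hT hc]⟩
        intro hcon
        have h1 : w = D.par (D.par w) := hcon
        have h2 := D.lev_par (D.par w)
        rw [← h1, D.lev_par] at h2
        omega
      have hlt := IsWellFounded.rank_lt_of_rel hnext
      by_cases hpx : D.par w = x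
      · rwa [hpx] at hlt ⊢
      · refine hlt.trans (ih _ hp hpx (by rw [D.lev_par]; omega) ?_)
        exact hbig.trans (Cardinal.mk_le_mk_of_subset (D.below_subset (D.mem_par w)))
  exact key _ w hw hne rfl hbig

/-- Otherwise the neighbour `z` of `u` towards `v` would have smaller rank. Darts leaving `z` away
from `u` continue `(u, z)`; the dart `(z, u)` lies beyond the first dart `(v, v')` of the path from
`v` to `u`. So all darts that count have rank below that of `(u, z)` or `(v, v')`, both of which are
below the minimum. -/
theorem eq_or_adj_of_rank_minimal (hT : T.IsTree) (hm : ℵ₀ ≤ m) (hV : m ≤ #V) {u v : V}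
    (hu : ∀ w, IsWellFounded.rank (Next T m) (u, u) ≤ IsWellFounded.rank (Next T m) (w, w))
    (hv : ∀ w, IsWellFounded.rank (Next T m) (v, v) ≤ IsWellFounded.rank (Next T m) (w, w)) :
    v = u ∨ T.Adj u v := by
  by_contra! hcon
  obtain ⟨hne, hnadj⟩ := hcon
  set D := rootedAt hT u with hD
  set z := D.anc 1 v with hz
  have hzu : D.IsChild z u := by
    have := D.isChild_anc (y := u) (D.mem_root v) hne
    have hl : D.lev u = 0 := D.lev_root
    rwa [hl] at this
  have hvz : v ∈ D.below z := D.anc_mem _ _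
  have hadj : T.Adj u z := adj_of_isChild hT hzu
  set D' := rootedAt hT v with hD'
  have huz' : D'.IsChild u z := by
    refine isChild_of_dist hT hadj.symm ?_
    rw [below_eq_side hT hzu] at hvz
    have h1 : T.dist v z < T.dist v u := hvz
    rcases hT.dist_eq_dist_add_one_of_adj v hadj with h2 | h2 <;> omega
  set v' := D'.anc 1 u with hv'
  have hv'v : D'.IsChild v' v := by
    have := D'.isChild_anc (y := v) (D'.mem_root u) (Ne.symm hne)
    have hl : D'.lev v = 0 := D'.lev_root
    rwa [hl] at this
  have huv' : u ∈ D'.below v' := D'.anc_mem _ _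
  have hune : u ≠ v' := by
    intro h
    have := adj_of_isChild hT hv'v
    rw [← h] at this
    exact hnadj this.symm
  have hcase : m ≤ #(side T u z) ∨ m ≤ #(side T z u) := by
    by_contra! hlt
    have h1 : #V ≤ #(side T u z) + #(side T z u) := by
      rw [← Cardinal.mk_univ, ← Set.union_compl_self (side T u z), compl_side hT hadj]
      exact Cardinal.mk_union_le _ _
    exact absurd (hV.trans h1) (Cardinal.add_lt_of_lt hm hlt.1 hlt.2).not_ge
  have hrank1 : m ≤ #(side T u z) → IsWellFounded.rank (Next T m) (u, z) <
      IsWellFounded.rank (Next T m) (u, u) := fun h =>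
    IsWellFounded.rank_lt_of_rel (next_self_iff.2 ⟨rfl, hadj, h⟩)
  have hbig' : m ≤ #(side T z u) → m ≤ #(D'.below u) := fun h => by
    rwa [below_eq_side hT huz']
  have hrank2 : m ≤ #(side T z u) → IsWellFounded.rank (Next T m) (v, v') <
      IsWellFounded.rank (Next T m) (u, u) := fun h => by
    have h2 : IsWellFounded.rank (Next T m) (v, v') < IsWellFounded.rank (Next T m) (v, v) := by
      refine IsWellFounded.rank_lt_of_rel (next_self_iff.2 ⟨rfl, adj_of_isChild hT hv'v, ?_⟩)
      rw [← below_eq_side hT hv'v]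
      exact (hbig' h).trans (Cardinal.mk_le_mk_of_subset (D'.below_subset huv'))
    exact h2.trans_le (hv u)
  have hzero : 0 < IsWellFounded.rank (Next T m) (u, u) := by
    rcases hcase with h | h
    · exact (zero_le).trans_lt (hrank1 h)
    · exact (zero_le).trans_lt (hrank2 h)
  classical
  -- A dart into a branch smaller than `m` does not count and is replaced by 0, which is below the
  -- minimum by `hzero`.
  refine absurd (hu z) (not_le.2 (lt_of_le_of_lt (rank_le_of_forall_lt (α := max
    (if m ≤ #(side T u z) then IsWellFounded.rank (Next T m) (u, z) else 0)
    (if m ≤ #(side T z u) then IsWellFounded.rank (Next T m) (v, v') else 0)) ?_) (max_lt ?_ ?_)))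
  · rintro ⟨a, b⟩ hq
    obtain ⟨h1, h2, h3⟩ := next_self_iff.1 hq
    dsimp only at h1 h2 h3
    subst h1
    by_cases hbu : b = u
    · subst hbu
      refine lt_max_of_lt_right ?_
      rw [if_pos h3]
      have h4 := rank_lt_of_mem_below (r := v) hT huv' hune (hbig' h3)
      rwa [← hD', huz'.2, hv'v.2] at h4
    · refine lt_max_of_lt_left ?_
      have hbz : D.IsChild b z := isChild_of_adj_of_ne hT h2 (by rwa [← hD, hzu.2])
      have h4 : m ≤ #(side T u z) := by
        rw [← below_eq_side hT hzu]
        rw [← below_eq_side hT hbz] at h3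
        exact h3.trans (Cardinal.mk_le_mk_of_subset (D.below_subset (IsChild.mem D hbz)))
      rw [if_pos h4]
      exact IsWellFounded.rank_lt_of_rel ⟨rfl, h2, hbu, h3⟩
  · split_ifs with h
    · exact hrank1 h
    · exact hzero
  · split_ifs with h
    · exact hrank2 h
    · exact hzero

/-- There is a vertex which every automorphism fixes or moves to a neighbour, exchanging the two. -/
theorem exists_center (hT : T.IsTree) (hm : ℵ₀ ≤ m) (hV : m ≤ #V) :
    ∃ c : V, ∀ φ : T ≃g T, φ c ≠ c → T.Adj c (φ c) ∧ φ (φ c) = c := by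
  have : Nonempty V := hT.connected.nonempty
  obtain ⟨c, -, hc⟩ := exists_minimalFor_of_wellFoundedLT (fun _ : V => True)
    (fun v => IsWellFounded.rank (Next T m) (v, v)) ⟨Classical.arbitrary V, trivial⟩
  have hmin : ∀ w, IsWellFounded.rank (Next T m) (c, c) ≤ IsWellFounded.rank (Next T m) (w, w) :=
    fun w => (le_total _ _).elim id fun h => hc trivial h
  have hstep : ∀ (φ : T ≃g T) (d : V),
      (∀ w, IsWellFounded.rank (Next T m) (d, d) ≤ IsWellFounded.rank (Next T m) (w, w)) →
      ∀ w, IsWellFounded.rank (Next T m) (φ d, φ d) ≤ IsWellFounded.rank (Next T m) (w, w) :=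
    fun φ d hd w => (rank_map_le hT φ (d, d)).trans (hd w)
  refine ⟨c, fun φ hφ => ?_⟩
  have h1 := hstep φ c hmin
  have h2 := hstep φ _ h1
  have h3 := (eq_or_adj_of_rank_minimal hT hm hV hmin h1).resolve_left hφ
  refine ⟨h3, ?_⟩
  by_contra hne
  have h4 := (eq_or_adj_of_rank_minimal hT hm hV hmin h2).resolve_left hne
  have h5 : T.Adj (φ c) (φ (φ c)) := φ.map_adj_iff.2 h3
  have h6 := hT.dist_ne_of_adj c h5
  -- Otherwise `c`, `φ c`, `φ (φ c)` would form a triangle.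
  rw [SimpleGraph.dist_eq_one_iff_adj.2 h3, SimpleGraph.dist_eq_one_iff_adj.2 h4] at h6
  exact h6 rfl

end Center

end AsymTree

/-! ### Automorphisms that move the root, and the conclusion -/

namespace AsymTree

open Rooted

/-- A partition of `ℕ` into infinite classes and an aperiodic pattern on the class of `1`. -/
theorem exists_aperiodic_pattern : ∃ (ind : ℕ → ℕ) (pat : ℕ → Prop),
    (∀ j N, ∃ n ≥ N, ind n = j) ∧
      ∀ s > 0, ∀ N, ∃ n ≥ N, ind n = 1 ∧ ind (n + s) = 1 ∧ ¬ (pat n ↔ pat (n + s)) := by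
  -- Dyadic blocks with even exponent form class 1, so that `n` and `n + s` lie together in a long
  -- block. The pattern marks the powers of two: the start of such a block is marked, its shift by
  -- `s` is not.
  refine ⟨fun n => if Even (Nat.log 2 n) then 1 else (Nat.log 2 n / 2).unpair.1,
    fun n => n = 2 ^ Nat.log 2 n, fun j N => ?_, fun s hs N => ?_⟩
  · refine ⟨2 ^ (2 * Nat.pair j N + 1), ?_, ?_⟩
    · have h1 := Nat.right_le_pair j N
      have h2 : 2 * Nat.pair j N + 1 < 2 ^ (2 * Nat.pair j N + 1) := Nat.lt_two_pow_self
      omega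
    · have h1 : ¬ Even (2 * Nat.pair j N + 1) := by
        rw [Nat.not_even_iff_odd]
        exact odd_two_mul_add_one _
      have h2 : (2 * Nat.pair j N + 1) / 2 = Nat.pair j N := by omega
      simp only [Nat.log_pow one_lt_two, h1, if_false, h2, Nat.unpair_pair]
  · have h1 : 2 * (N + s) < 2 ^ (2 * (N + s)) := Nat.lt_two_pow_self
    have h2 : Nat.log 2 (2 ^ (2 * (N + s)) + s) = 2 * (N + s) := by
      refine Nat.log_eq_of_pow_le_of_lt_pow (by omega) ?_
      rw [pow_succ]
      omega
    refine ⟨2 ^ (2 * (N + s)), by omega, ?_, ?_, ?_⟩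
    · simp [Nat.log_pow one_lt_two]
    · simp [h2]
    · intro hc
      have h3 : 2 ^ (2 * (N + s)) + s = 2 ^ Nat.log 2 (2 ^ (2 * (N + s)) + s) :=
        hc.1 (by simp only [Nat.log_pow one_lt_two])
      rw [h2] at h3
      omega

variable {V : Type u} {T : SimpleGraph V} {m : Cardinal.{u}}

theorem not_acc_iff (hT : T.IsTree) {r x y : V} (h : (rootedAt hT r).IsChild x y) :
    ¬ (rootedAt hT r).Good m x ↔ ¬ Acc (Next T m) (y, x) := not_congr (good_iff_acc hT h)

/-- An automorphism preserving a set with an aperiodic pattern maps each ray of vertices which are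
not good to a ray that eventually runs through the same levels. -/
theorem eventually_same_level (hT : T.IsTree) {r : V} {ind : ℕ → ℕ} {pat : ℕ → Prop}
    (hap : ∀ s > 0, ∀ N, ∃ n ≥ N, ind n = 1 ∧ ind (n + s) = 1 ∧ ¬ (pat n ↔ pat (n + s)))
    {S : V → Prop}
    (hS : ∀ y, ¬ (rootedAt hT r).Good m y → ind ((rootedAt hT r).lev y) = 1 →
      (S y ↔ pat ((rootedAt hT r).lev y)))
    {x : ℕ → V} (hx0 : x 0 = r) (hx : ∀ i, x (i + 1) ∈ (rootedAt hT r).limbs m (x i))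
    (φ : T ≃g T) (hφ : ∀ y, S (φ y) ↔ S y) (hr : φ r ≠ r) :
    φ (x 1) = (rootedAt hT r).par (φ r) ∧
      ∃ j, ∀ i > j, ¬ (rootedAt hT r).Good m (φ (x i)) ∧ (rootedAt hT r).lev (φ (x i)) = i := by
  classical
  set D := rootedAt hT r with hD
  have hlevx : ∀ i, D.lev (x i) = i := by
    intro i
    induction i with
    | zero =>
      rw [hx0]
      exact D.lev_root
    | succ i ih => rw [IsChild.lev D (hx i).1, ih]
  have hadj : ∀ i, T.Adj (φ (x i)) (φ (x (i + 1))) := fun i =>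
    φ.map_adj_iff.2 (adj_of_isChild hT (hx i).1)
  have hne : ∀ i, φ (x (i + 2)) ≠ φ (x i) := by
    intro i h
    have h1 := congrArg D.lev (φ.injective h)
    rw [hlevx, hlevx] at h1
    omega
  have hdart : ∀ i, ¬ Acc (Next T m) (φ (x i), φ (x (i + 1))) := by
    intro i
    rw [acc_map_iff hT]
    exact (not_acc_iff hT (hx i).1).1 (hx i).2
  -- The image ray approaches the root for `j` steps and, as it cannot turn back, leaves it forever
  -- afterwards. Its levels then differ from the original ones by a constant.
  have hex : ∃ j, D.IsChild (φ (x (j + 1))) (φ (x j)) := by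
    by_contra! hcon
    have h1 : ∀ i, D.lev (φ (x i)) + i = D.lev (φ (x 0)) := by
      intro i
      induction i with
      | zero => simp
      | succ i ih =>
        have := IsChild.lev D ((isChild_or_isChild hT r (hadj i)).resolve_right (hcon i))
        omega
    have := h1 (D.lev (φ (x 0)) + 1)
    omega
  set j := Nat.find hex with hj
  have hdown : ∀ i < j, D.IsChild (φ (x i)) (φ (x (i + 1))) := fun i hi =>
    (isChild_or_isChild hT r (hadj i)).resolve_right (Nat.find_min hex hi)
  have hup : ∀ t, D.IsChild (φ (x (j + t + 1))) (φ (x (j + t))) := by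
    intro t
    induction t with
    | zero => exact Nat.find_spec hex
    | succ t ih =>
      refine isChild_of_adj_of_ne hT (hadj _) ?_
      change φ (x (j + t + 2)) ≠ D.par (φ (x (j + t + 1)))
      rw [ih.2]
      exact hne _
  have hl1 : ∀ i ≤ j, D.lev (φ (x i)) + i = D.lev (φ (x 0)) := by
    intro i
    induction i with
    | zero => simp
    | succ i ih =>
      intro hi
      have h1 := ih (by omega)
      have h2 := IsChild.lev D (hdown i (by omega))
      omega
  have hl2 : ∀ t, D.lev (φ (x (j + t))) = D.lev (φ (x j)) + t := by
    intro t
    induction t with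
    | zero => rfl
    | succ t ih =>
      have h2 := IsChild.lev D (hup t)
      rw [ih] at h2
      exact h2
  have hbad : ∀ i > j, ¬ D.Good m (φ (x i)) := by
    intro i hi
    obtain ⟨t, rfl⟩ : ∃ t, i = j + t + 1 := ⟨i - j - 1, by omega⟩
    exact (not_acc_iff hT (hup t)).2 (hdart _)
  have hxbad : ∀ i > j, ¬ D.Good m (x i) := by
    intro i hi
    obtain ⟨t, rfl⟩ : ∃ t, i = j + t + 1 := ⟨i - j - 1, by omega⟩
    exact (hx _).2
  have hlev : ∀ i ≥ j, D.lev (φ (x i)) + 2 * j = D.lev (φ (x 0)) + i := by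
    intro i hi
    obtain ⟨t, rfl⟩ : ∃ t, i = j + t := ⟨i - j, by omega⟩
    have h1 := hl1 j le_rfl
    have h2 := hl2 t
    omega
  have hpat : ∀ i > j, ind i = 1 → ind (D.lev (φ (x i))) = 1 →
      (pat i ↔ pat (D.lev (φ (x i)))) := by
    intro i hi h1 h2
    rw [← hS _ (hbad i hi) h2, hφ]
    have h3 := hS _ (hxbad i hi) (by rwa [hlevx])
    rw [hlevx] at h3
    exact h3.symm
  -- A nonzero shift of levels would make the pattern eventually periodic in the sense excluded by
  -- `hap`.
  have hd : D.lev (φ (x 0)) = 2 * j := by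
    rcases lt_trichotomy (D.lev (φ (x 0))) (2 * j) with hlt | heq | hgt
    · obtain ⟨n, hn, h1, h2, h3⟩ := hap (2 * j - D.lev (φ (x 0))) (by omega) (j + 1)
      have h4 := hlev (n + (2 * j - D.lev (φ (x 0)))) (by omega)
      have h5 : D.lev (φ (x (n + (2 * j - D.lev (φ (x 0)))))) = n := by omega
      have h6 := hpat (n + (2 * j - D.lev (φ (x 0)))) (by omega) h2 (by rwa [h5])
      rw [h5] at h6
      exact absurd h6.symm h3
    · exact heq
    · obtain ⟨n, hn, h1, h2, h3⟩ := hap (D.lev (φ (x 0)) - 2 * j) (by omega) (j + 1)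
      have h4 := hlev n (by omega)
      have h5 : D.lev (φ (x n)) = n + (D.lev (φ (x 0)) - 2 * j) := by omega
      have h6 := hpat n (by omega) h1 (by rwa [h5])
      rw [h5] at h6
      exact absurd h6 h3
  have hpos : 0 < j := by
    have h1 : D.lev (φ (x 0)) ≠ 0 := by
      rw [hx0, Ne, lev_eq_zero]
      exact hr
    omega
  refine ⟨?_, j, fun i hi => ⟨hbad i hi, ?_⟩⟩
  · have h1 := (hdown 0 hpos).2
    rw [hx0] at h1
    exact h1.symm
  · have := hlev i hi.le
    omega

theorem exists_ray {D : Rooted V} {y : V} (hy : y ∈ D.limbs m D.root) :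
    ∃ x : ℕ → V, x 0 = D.root ∧ x 1 = y ∧ ∀ i, x (i + 1) ∈ D.limbs m (x i) := by
  have hnext : ∀ w, ¬ D.Good m w → ∃ z, z ∈ D.limbs m w := fun w hw => by
    obtain ⟨z, hz, hgz⟩ := exists_child_not_good hw
    exact ⟨z, hz, hgz⟩
  choose! next hn using hnext
  have hbad : ∀ i, ¬ D.Good m (next^[i] y) := by
    intro i
    induction i with
    | zero => exact hy.2
    | succ i ih =>
      rw [Function.iterate_succ_apply']
      exact (hn _ ih).2
  refine ⟨fun i => match i with
    | 0 => D.root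
    | i + 1 => next^[i] y, rfl, rfl, fun i => ?_⟩
  match i with
  | 0 => exact hy
  | i + 1 =>
    change next^[i + 1] y ∈ D.limbs m (next^[i] y)
    rw [Function.iterate_succ_apply']
    exact hn _ (hbad i)

theorem image_eq_iff {S S' : V → Prop} {φ : T ≃g T} :
    φ '' {v | S v} = {v | S' v} ↔ ∀ y, S' (φ y) = S y := by
  constructor
  · intro h y
    refine propext ⟨fun hy => ?_, fun hy => ?_⟩
    · have h1 : φ y ∈ φ '' {v | S v} := h ▸ hy
      obtain ⟨w, hw, he⟩ := h1
      rw [← φ.injective he]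
      exact hw
    · have h1 : φ y ∈ {v | S' v} := h ▸ Set.mem_image_of_mem φ hy
      exact h1
  · intro h
    ext w
    constructor
    · rintro ⟨y, hy, rfl⟩
      exact (h y).mpr hy
    · intro hw
      refine ⟨φ.symm w, ?_, by simp⟩
      have := h (φ.symm w)
      rw [RelIso.apply_symm_apply] at this
      exact this.mp hw

theorem asymmetrizingNumber_le (T : SimpleGraph V) : asymmetrizingNumber T ≤ 2 ^ #V := by
  refine Cardinal.mk_quotient_le.trans ?_
  rw [← Cardinal.mk_set]
  exact Cardinal.mk_subtype_le _

/-- It is enough to find sets which are inequivalent under the automorphisms that fix `r`. -/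
theorem asymmetrizable_of_family [Infinite V] {H : Type u} (S : H → V → Prop) (hH : 2 ^ #V ≤ #H)
    (hS : ∀ h, IsAsymmetrizing T {v | S h v}) (r : V)
    (hne : ∀ h h' (φ : T ≃g T), φ r = r → (∀ y, S h' (φ y) = S h y) → h = h') :
    IsAsymmetrizable T ∧ asymmetrizingNumber T = 2 ^ #V := by
  have hHne : Nonempty H := by
    rw [← Cardinal.mk_ne_zero_iff]
    exact ((Cardinal.power_pos _ two_pos).trans_le hH).ne'
  refine ⟨⟨_, hS (Classical.arbitrary H)⟩, (asymmetrizingNumber_le T).antisymm ?_⟩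
  let q : H → Quotient (asymSetoid T) := fun h => Quotient.mk _ ⟨_, hS h⟩
  have hq : ∀ h, Equivalent T T (q h).out.1 {v | S h v} := fun h =>
    Quotient.exact (Quotient.out_eq (q h))
  choose ψ hψ using hq
  -- Inside one class, the preimage of `r` under the isomorphism from the chosen representative
  -- determines `h`: equal preimages compose to an automorphism fixing `r`. So $2^{|V|} \le
  -- a(T)\cdot|V|$.
  have hinj : Function.Injective fun h => (q h, (ψ h).symm r) := by
    intro h h' he
    obtain ⟨h1, h2⟩ := Prod.mk.inj he
    have h3 := hψ h
    rw [h1] at h3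
    refine hne h h' ((ψ h).symm.trans (ψ h')) ?_ (image_eq_iff.1 ?_)
    · change ψ h' ((ψ h).symm r) = r
      rw [h2, RelIso.apply_symm_apply]
    · rw [← h3, ← hψ h']
      ext w
      simp
  have h1 := Cardinal.mk_le_of_injective hinj
  rw [← Cardinal.mul_def] at h1
  by_contra! hlt
  have hV : ℵ₀ ≤ #V := Cardinal.aleph0_le_mk V
  exact absurd (hH.trans h1) (Cardinal.mul_lt_of_lt (hV.trans (Cardinal.cantor _).le) hlt
    (Cardinal.cantor _)).not_ge

theorem isAsymmetrizing_of_fixes {S : V → Prop} {r : V}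
    (hfix : ∀ φ : T ≃g T, (∀ y, S (φ y) = S y) → φ r = r)
    (hid : ∀ φ : T ≃g T, φ r = r → (∀ y, S (φ y) = S y) → ∀ y, φ y = y) :
    IsAsymmetrizing T {v | S v} := by
  intro φ hφ
  have h1 := image_eq_iff.1 hφ
  exact RelIso.ext (hid φ (hfix φ h1) h1)

theorem asymmetrizable_of_small (hmot : MotionAtLeast T m) (hV : #V < m) :
    IsAsymmetrizable T ∧ asymmetrizingNumber T = 2 ^ #V := by
  have hid : ∀ φ : T ≃g T, φ = RelIso.refl T.Adj := by
    intro φ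
    by_contra hne
    exact absurd ((hmot φ hne).trans (Cardinal.mk_subtype_le _)) hV.not_ge
  have hall : ∀ S : Set V, IsAsymmetrizing T S := fun S φ _ => hid φ
  refine ⟨⟨∅, hall ∅⟩, (asymmetrizingNumber_le T).antisymm ?_⟩
  rw [← Cardinal.mk_set]
  refine Cardinal.mk_le_of_injective
    (f := fun S : Set V => Quotient.mk (asymSetoid T) ⟨S, hall S⟩) ?_
  intro S S' h
  obtain ⟨φ, hφ⟩ := Quotient.exact h
  rw [hid φ] at hφ
  simpa using hφ

/-- Root the tree at the centre `r`, which is coloured, while its neighbours with infinite branches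
are not. An edge flip at `r` would put `r` and its image into halves of equal, hence infinite, size,
and they have different colours. -/
theorem asymmetrizable_of_good (hT : T.IsTree) (hm : ℵ₀ ≤ m) (hV : m ≤ #V)
    (hadm : ∀ r, (rootedAt hT r).Admissible m) (hwf : WellFounded (Next T m)) :
    IsAsymmetrizable T ∧ asymmetrizingNumber T = 2 ^ #V := by
  have : IsWellFounded (V × V) (Next T m) := ⟨hwf⟩
  have hVinf : Infinite V := Cardinal.infinite_iff.2 (hm.trans hV)
  obtain ⟨r, hr⟩ := exists_center (m := m) hT hm hV
  set D := rootedAt hT r with hD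
  have hbelow : D.below r = Set.univ := D.below_root
  obtain ⟨S, hS, hinj⟩ := (hadm r).exists_coloring (x := r) (fun z hz => Good.plentiful (hadm r)
    ((good_of_wellFounded hT hwf r).of_mem (D.mem_root z))) True False
  have hty : ∀ h h' (φ : T ≃g T), φ r = r → (∀ y, S h' (φ y) = S h y) → h = h' :=
    fun h h' φ hφ hy => hinj (D.ty_eq_iff.2 ⟨φ, φ.symm, isIso_of_fixes hT φ hφ, fun w _ => hy w⟩)
  refine asymmetrizable_of_family S ?_ (fun h => isAsymmetrizing_of_fixes (r := r) ?_ ?_) r hty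
  · rw [Cardinal.mk_set]
    refine Cardinal.power_le_power_left two_ne_zero ?_
    rw [← hD, hbelow, ← Set.compl_eq_univ_sdiff]
    rw [Cardinal.mk_compl_of_infinite _ (by
      rw [Cardinal.mk_singleton]
      exact Cardinal.one_lt_aleph0.trans_le (Cardinal.aleph0_le_mk V))]
  · intro φ hφ
    by_contra hne
    obtain ⟨hadj, hinv⟩ := hr φ hne
    have hch : D.IsChild (φ r) r := (isChild_root_iff hT).2 hadj
    have hSr : S h r := (hS h).2.1.2 trivial
    have hinf : ℵ₀ ≤ #(D.below (φ r)) := by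
      by_contra! hlt
      have h1 := mk_side_map hT φ r (φ r)
      rw [hinv] at h1
      rw [below_eq_side hT hch] at hlt
      have h2 : #V ≤ #(side T r (φ r)) + #(side T (φ r) r) := by
        rw [← Cardinal.mk_univ, ← Set.union_compl_self (side T r (φ r)), compl_side hT hadj]
        exact Cardinal.mk_union_le _ _
      rw [h1] at h2
      exact absurd ((Cardinal.aleph0_le_mk V).trans h2) (Cardinal.add_lt_aleph0 hlt hlt).not_ge
    have h3 := (hS h).2.2 _ hch hinf
    rw [hφ] at h3
    exact h3.1 hSr
  · intro φ hr hφ y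
    exact (hS h).1 φ φ.symm (isIso_of_fixes hT φ hr) (fun w _ => hφ w) y (D.mem_root y)

theorem asymmetrizable_of_not_good (hT : T.IsTree) (hm : ℵ₀ ≤ m) (hV : m ≤ #V)
    (hadm : ∀ r, (rootedAt hT r).Admissible m)
    (hbad : ∀ r, ¬ (rootedAt hT r).Good m r) :
    IsAsymmetrizable T ∧ asymmetrizingNumber T = 2 ^ #V := by
  have hVinf : Infinite V := Cardinal.infinite_iff.2 (hm.trans hV)
  have hVne : Nonempty V := hT.connected.nonempty
  obtain ⟨ind, pat, hind, hap⟩ := exists_aperiodic_pattern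
  -- Either some root starts two different bad darts, or every vertex starts at most one and the bad
  -- vertices form a single ray.
  have hroot : ∃ r : V, (∃ a b, a ≠ b ∧ T.Adj r a ∧ T.Adj r b ∧ ¬ Acc (Next T m) (r, a) ∧
      ¬ Acc (Next T m) (r, b)) ∨ ∀ v a b, T.Adj v a → T.Adj v b → ¬ Acc (Next T m) (v, a) →
        ¬ Acc (Next T m) (v, b) → a = b := by
    by_cases h : ∃ r a b, a ≠ b ∧ T.Adj r a ∧ T.Adj r b ∧ ¬ Acc (Next T m) (r, a) ∧
      ¬ Acc (Next T m) (r, b)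
    · obtain ⟨r, h⟩ := h
      exact ⟨r, Or.inl h⟩
    · refine ⟨Classical.arbitrary V, Or.inr fun v a b ha hb ha' hb' => ?_⟩
      by_contra hne
      exact h ⟨v, a, b, hne, ha, hb, ha', hb'⟩
  obtain ⟨r, hr⟩ := hroot
  set D := rootedAt hT r with hD
  obtain ⟨H, S, hH, hiso, hSpat, hSgood⟩ := (hadm r).exists_family (hbad r) hind pat
  have hiso' : ∀ h h' (φ : T ≃g T), φ r = r → (∀ y, S h' (φ y) = S h y) →
      h = h' ∧ ∀ y, φ y = y := fun h h' φ hφ hy =>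
    hiso h h' φ φ.symm (isIso_of_fixes hT φ hφ) hy
  refine asymmetrizable_of_family S hH (fun h => isAsymmetrizing_of_fixes (r := r) ?_
    fun φ hφ hy => (hiso' h h φ hφ hy).2) r fun h h' φ hφ hy => (hiso' h h' φ hφ hy).1
  intro φ hφ
  by_contra hne
  have hφ' : ∀ y, S h (φ y) ↔ S h y := fun y => by rw [hφ]
  have hray := fun (x : ℕ → V) (hx0 : x 0 = r) hx =>
    eventually_same_level (x := x) hT hap (hSpat h) hx0 hx φ hφ' hne
  rcases hr with ⟨a, b, hab, ha, hb, ha', hb'⟩ | huniq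
  · have hlimb : ∀ a, T.Adj r a → ¬ Acc (Next T m) (r, a) → φ a = D.par (φ r) := by
      intro a ha ha'
      have hch : D.IsChild a r := (isChild_root_iff hT).2 ha
      obtain ⟨x, hx0, hx1, hx⟩ := exists_ray (m := m) (D := D) (y := a)
        ⟨hch, (not_acc_iff hT hch).2 ha'⟩
      rw [← hx1]
      exact (hray x hx0 hx).1
    -- If the root moves, both rays must start towards the old root after applying `φ`, so `a` and
    -- `b` have the same image.
    exact hab (φ.injective ((hlimb a ha ha').trans (hlimb b hb hb').symm))
  · obtain ⟨y, hy, hgy⟩ := exists_child_not_good (hbad r)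
    obtain ⟨x, hx0, -, hx⟩ := exists_ray (m := m) (D := D) (y := y) ⟨hy, hgy⟩
    have hx0 : x 0 = r := hx0
    have hxadj : ∀ i, T.Adj (x i) (x (i + 1)) := fun i => adj_of_isChild hT (hx i).1
    have hxacc : ∀ i, ¬ Acc (Next T m) (x i, x (i + 1)) := fun i =>
      (not_acc_iff hT (hx i).1).1 (hx i).2
    have hxeq : ∀ i w, ¬ D.Good m w → D.lev w = i → w = x i := by
      intro i
      induction i with
      | zero =>
        intro w _ hl
        rw [hx0]
        exact D.lev_eq_zero.1 hl
      | succ i ih =>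
        intro w hw hl
        have hwr : w ≠ D.root := by
          rw [Ne, ← lev_eq_zero]
          omega
        have hp := ih (D.par w) (not_good_of_mem hw (D.mem_par w)) (by rw [D.lev_par]; omega)
        have hch : D.IsChild w (x i) := ⟨hwr, hp⟩
        exact huniq (x i) _ _ (adj_of_isChild hT hch) (hxadj i) ((not_acc_iff hT hch).1 hw)
          (hxacc i)
    obtain ⟨-, j, hj⟩ := hray x hx0 hx
    -- Levels are eventually preserved and each level contains just one bad vertex, so the ray is
    -- eventually fixed. The contradiction comes at its first fixed vertex `x (k + 1)`.
    have hex : ∃ i, φ (x i) = x i := ⟨j + 1, hxeq _ _ (hj _ (by omega)).1 (hj _ (by omega)).2⟩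
    classical
    have hi := Nat.find_spec hex
    have hmin := fun i => Nat.find_min (H := hex) (m := i)
    generalize Nat.find hex = i at hi hmin
    match i with
    | 0 =>
      rw [hx0] at hi
      exact hne hi
    | k + 1 =>
      have hk : φ (x k) ≠ x k := hmin k (by omega)
      have hadj : T.Adj (x (k + 1)) (φ (x k)) := by
        have := φ.map_adj_iff.2 (hxadj k).symm
        rwa [hi] at this
      have hch : D.IsChild (φ (x k)) (x (k + 1)) :=
        isChild_of_adj_of_ne hT hadj (by rw [← hD, (hx k).1.2]; exact hk)
      -- Otherwise uniqueness of bad darts at `x (k + 1)` identifies `φ (x k)` with `x (k + 2)`,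
      -- which `φ` fixes.
      have hgood : D.Good m (φ (x k)) := by
        by_contra hg
        have h1 := huniq _ _ _ hadj (hxadj (k + 1)) ((not_acc_iff hT hch).1 hg) (hxacc (k + 1))
        have h2 : φ (x (k + 2)) = x (k + 2) := by
          refine huniq (x (k + 1)) _ _ ?_ (hxadj (k + 1)) ?_ (hxacc (k + 1))
          · have := φ.map_adj_iff.2 (hxadj (k + 1))
            rwa [hi] at this
          · have h3 := hxacc (k + 1)
            rwa [← acc_map_iff hT φ, hi] at h3
        have h3 : x k = x (k + 2) := φ.injective (h1.trans h2.symm)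
        have h4 := IsChild.lev D (hx k).1
        have h5 := IsChild.lev D (hx (k + 1)).1
        rw [h3] at h4
        have h6 : D.lev (x (k + 1 + 1)) = D.lev (x (k + 2)) := rfl
        omega
      -- Seen from the fixed vertex `x (k + 1)`, the branches at `x k` and `φ (x k)` are isomorphic
      -- siblings, so motion makes them large.
      have hinf : ℵ₀ ≤ #(D.below (φ (x k))) := by
        have hc1 : (rootedAt hT (x (k + 1))).IsChild (x k) (x (k + 1)) :=
          (isChild_root_iff hT).2 (hxadj k).symm
        have hc2 : (rootedAt hT (x (k + 1))).IsChild (φ (x k)) (x (k + 1)) :=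
          (isChild_root_iff hT).2 hadj
        have h1 := (hadm (x (k + 1))).motion _ _ _ hc2 hc1 hk
          (((isIso_of_fixes hT φ hi).rel ((rootedAt hT (x (k + 1))).mem_root (x k))).symm)
        rw [below_eq_side hT hc2, ← below_eq_side hT hch] at h1
        exact hm.trans h1
      -- Large good children were coloured opposite to their grandparent, here `x k`, but `φ`
      -- preserves the colour of `x k`.
      have h1 := hSgood h (x (k + 1)) _ (hx k).2 hch hgood hinf
      rw [hφ, (hx k).1.2] at h1
      exact iff_not_self h1

end AsymTree

theorem theorem1 {V : Type u} (T : SimpleGraph V) (hT : T.IsTree)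
    (m : Cardinal.{u}) (hm : ℵ₀ ≤ m)
    (hdeg : ∀ v : V, #(T.neighborSet v) ≤ 2 ^ m)
    (hmot : AsymTree.MotionAtLeast T m) :
    AsymTree.IsAsymmetrizable T ∧ AsymTree.asymmetrizingNumber T = 2 ^ #V := by
  rcases lt_or_ge #V m with hV | hV
  · exact AsymTree.asymmetrizable_of_small hmot hV
  have hadm := AsymTree.admissible_rootedAt hT hm hdeg hmot
  by_cases hgood : ∃ r, (AsymTree.rootedAt hT r).Good m r
  · obtain ⟨r, hr⟩ := hgood
    exact AsymTree.asymmetrizable_of_good hT hm hV hadm (AsymTree.wellFounded_of_good hT hr)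
  · push Not at hgood
    exact AsymTree.asymmetrizable_of_not_good hT hm hV hadm hgood
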